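/- Let $n\ge 1$ and let $f,g_1,\dots,g_m$ be real-valued complex polynomials on $\mathbb{C}^n$, $\varphi(z)=\sum_{\alpha,\beta}\varphi_{\alpha,\beta}\bar z^\alpha z^\beta$. Consider the problem of minimizing $f(z)$ over $z\in\mathbb{C}^n$ subject to $g_i(z)\ge 0$, $i=1,\dots,m$. Assume (sphere assumption) that one of the constraints is $|z_1|^2+\dots+|z_n|^2=R^2$ for some $R>0$, imposed as two opposite inequalities $\pm(R^2-\sum_j|z_j|^2)\ge 0$. For a real-valued complex polynomial $\varphi$ let $\operatorname{ord}\varphi$ be the largest value of $\max(|\alpha|,|\beta|)$ over all $(\alpha,\beta)$ with $\varphi_{\alpha,\beta}\neq 0$ ($0$ if $\varphi=0$), and let $\tilde\varphi(x,y)=\varphi(x+\mathbf{i}y)$ be the associated real polynomial on $\mathbb{R}^{2n}$. Put $k_i=\operatorname{ord} g_i$, $v_i=\lceil \deg\tilde g_i/2\rceil$, $d^{\min}_{\mathbb{C}}=\max\{\operatorname{ord} f,k_1,\dots,k_m\}$ and $d^{\min}_{\mathbb{R}}=\max\{\lceil\deg\tilde f/2\rceil,v_1,\dots,v_m\}$.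 Let $\Sigma_d[z]$ be the set of finite sums $\sum_j|p_j|^2$ with $p_j$ holomorphic polynomials of degree at most $d$, let $\Sigma_d[x+\mathbf{i}y]$ be the set of the corresponding functions of $(x,y)\in\mathbb{R}^{2n}$, and let $\Sigma_d[x,y]$ be the set of finite sums of squares of real polynomials in $(x,y)$ of degree at most $d$. For $d\ge\max\{d^{\min}_{\mathbb{R}},d^{\min}_{\mathbb{C}}\}$ consider the following relaxations, each a pair of a moment problem and a sum-of-squares problem with values in $[-\infty,+\infty]$. (a) $\mathrm{MSOS}_d\text{-}\mathbb{C}$. Moment form: the infimum of $L_y(f)=\sum f_{\alpha,\beta}y_{\alpha,\beta}$ over Hermitian $y=(y_{\alpha,\beta})_{|\alpha|,|\beta|\le d}$ (that is, $\overline{y_{\alpha,\beta}}=y_{\beta,\alpha}$) with $y_{0,0}=1$, $M_d(y)\succcurlyeq 0$ and $M_{d-k_i}(g_iy)\succcurlyeq 0$ for all $i$, where $M_l(\varphi y)(\alpha,\beta)=\sum_{\gamma,\delta}\varphi_{\gamma,\delta}\,y_{\alpha+\gamma,\beta+\delta}$ for $|\alpha|,|\beta|\le l$ and $M_d(y)=M_d(1\cdot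 y)$. Sum-of-squares form: the supremum of $\lambda\in\mathbb{R}$ such that $f-\lambda=\sigma_0+\sum_i\sigma_ig_i$ with $\sigma_0\in\Sigma_d[z]$, $\sigma_i\in\Sigma_{d-k_i}[z]$. (b) $\mathrm{CMSOS}_d\text{-}\mathbb{R}$, the conversion of (a) into real numbers. Moment form: replace $y=a+\mathbf{i}b$ by the real variables $(a,b)$ and each constraint $M\succcurlyeq 0$ by $\begin{pmatrix}\operatorname{Re}M&-\operatorname{Im}M\\ \operatorname{Im}M&\operatorname{Re}M\end{pmatrix}\succcurlyeq 0$. Sum-of-squares form: the supremum of $\lambda\in\mathbb{R}$ such that $\tilde f-\lambda=\sigma_0+\sum_i\sigma_i\tilde g_i$ with $\sigma_0\in\Sigma_d[x+\mathbf{i}y]$, $\sigma_i\in\Sigma_{d-k_i}[x+\mathbf{i}y]$. (c) $\mathrm{MSOS}_d\text{-}\mathbb{R}$, the real Lasserre relaxation of the converted problem of minimizing $\tilde f(x,y)$ subject to $\tilde g_i(x,y)\ge 0$. Moment form: the infimum of $\sum_\kappa\tilde f_\kappa y_\kappa$ over real $y=(y_\kappa)_{\kappa\in\mathbb{N}^{2n},|\kappa|\le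 2d}$ with $y_0=1$, $M_d(y)\succcurlyeq 0$ and $M_{d-v_i}(\tilde g_iy)\succcurlyeq 0$ for all $i$, with the usual real moment and localizing matrices. Sum-of-squares form: the supremum of $\lambda\in\mathbb{R}$ such that $\tilde f-\lambda=\sigma_0+\sum_i\sigma_i\tilde g_i$ with $\sigma_0\in\Sigma_d[x,y]$, $\sigma_i\in\Sigma_{d-v_i}[x,y]$. Then in each of (a), (b), (c) the moment form and the sum-of-squares form have the same value, denoted $\mathrm{val}$, and $$\mathrm{val}(\mathrm{MSOS}_d\text{-}\mathbb{C})=\mathrm{val}(\mathrm{CMSOS}_d\text{-}\mathbb{R})\le\mathrm{val}(\mathrm{MSOS}_d\text{-}\mathbb{R}).$$ The same holds when $v_i$ is replaced by $k_i$ throughout (c). -/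

import Mathlib

open scoped ComplexOrder

noncomputable section

namespace CPOP

/-! ### Complex polynomials in `z̄, z`

A polynomial `∑ φ_{α,β} z̄^α z^β` is an `MvPolynomial` in `Fin n ⊕ Fin n`: the variables
`Sum.inl j` stand for `z̄_j` and the variables `Sum.inr j` stand for `z_j`. -/

/-- Multi-indices in `ℕⁿ`. -/
abbrev MIdx (n : ℕ) : Type := Fin n →₀ ℕ

/-- Multi-indices of length at most `d`. -/
abbrev MIdxLE (n d : ℕ) : Type := {α : MIdx n // α.degree ≤ d}

/-- Complex polynomials in `z̄, z`, given by their coefficients. -/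
abbrev CPoly (n : ℕ) : Type := MvPolynomial (Fin n ⊕ Fin n) ℂ

/-- Real polynomials in `(x, y)`: `Sum.inl j` stands for `x_j` and `Sum.inr j` for `y_j`. -/
abbrev RPoly (n : ℕ) : Type := MvPolynomial (Fin n ⊕ Fin n) ℝ

/-- The exponent `α` of `z̄` in the monomial `z̄^α z^β`. -/
def antiExp {n : ℕ} (κ : Fin n ⊕ Fin n →₀ ℕ) : MIdx n :=
  (Finsupp.sumFinsuppEquivProdFinsupp κ).1

/-- The exponent `β` of `z` in the monomial `z̄^α z^β`. -/
def holExp {n : ℕ} (κ : Fin n ⊕ Fin n →₀ ℕ) : MIdx n :=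
  (Finsupp.sumFinsuppEquivProdFinsupp κ).2

/-- The function `z ↦ ∑ φ_{α,β} z̄^α z^β`. -/
def evalC {n : ℕ} (φ : CPoly n) (z : Fin n → ℂ) : ℂ :=
  MvPolynomial.eval (Sum.elim (fun j => star (z j)) z) φ

/-- The order of `φ`: the least `k` such that `|α|, |β| ≤ k` whenever `φ_{α,β} ≠ 0`. -/
def order {n : ℕ} (φ : CPoly n) : ℕ :=
  φ.support.sup fun κ => max (antiExp κ).degree (holExp κ).degree

/-- The real polynomial `φ̃(x, y) = φ(x + iy)`: substitute `z̄ = x - iy` and `z = x + iy`, and keep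
the real parts of the coefficients (all of them are real when `φ` is real-valued). -/
def realify {n : ℕ} (φ : CPoly n) : RPoly n :=
  let Φ : CPoly n := MvPolynomial.aeval
    (Sum.elim
      (fun j => MvPolynomial.X (Sum.inl j) - MvPolynomial.C Complex.I * MvPolynomial.X (Sum.inr j))
      (fun j => MvPolynomial.X (Sum.inl j) + MvPolynomial.C Complex.I * MvPolynomial.X (Sum.inr j)))
    φ
  ∑ κ ∈ Φ.support, MvPolynomial.monomial κ (Φ.coeff κ).re

/-- `⌈deg F / 2⌉`. -/
def halfDegree {n : ℕ} (F : RPoly n) : ℕ := (F.totalDegree + 1) / 2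

/-- The polynomial `R² - |z_1|² - ⋯ - |z_n|²`. -/
def spherePoly (n : ℕ) (R : ℝ) : CPoly n :=
  MvPolynomial.C ((R : ℂ) ^ 2) -
    ∑ j : Fin n, MvPolynomial.X (Sum.inl j) * MvPolynomial.X (Sum.inr j)

/-! ### Sums of squares -/

/-- `Σ_d[z]`: sums of squared moduli of holomorphic polynomials of degree at most `d`. -/
def hermitianSOS (n d : ℕ) : Set ((Fin n → ℂ) → ℂ) :=
  {σ | ∃ (r : ℕ) (p : Fin r → MvPolynomial (Fin n) ℂ), (∀ j, (p j).totalDegree ≤ d) ∧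
    ∀ z, σ z = ∑ j, (Complex.normSq (MvPolynomial.eval z (p j)) : ℂ)}

/-- `Σ_d[x + iy]`: the functions `(x, y) ↦ ∑ |p_j(x + iy)|²` with `p_j` holomorphic of degree at
most `d`. -/
def convertedSOS (n d : ℕ) : Set ((Fin n ⊕ Fin n → ℝ) → ℝ) :=
  {σ | ∃ (r : ℕ) (p : Fin r → MvPolynomial (Fin n) ℂ), (∀ j, (p j).totalDegree ≤ d) ∧
    ∀ v, σ v = ∑ j, Complex.normSq
      (MvPolynomial.eval (fun l => (v (Sum.inl l) : ℂ) + Complex.I * v (Sum.inr l)) (p j))}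

/-- `Σ_d[x, y]`: sums of squares of real polynomials of degree at most `d`. -/
def realSOS (n d : ℕ) : Set ((Fin n ⊕ Fin n → ℝ) → ℝ) :=
  {σ | ∃ (r : ℕ) (q : Fin r → RPoly n), (∀ j, (q j).totalDegree ≤ d) ∧
    ∀ v, σ v = ∑ j, (MvPolynomial.eval v (q j)) ^ 2}

/-! ### Moment functionals and localizing matrices -/

/-- `L_y(z̄^α z^β φ) = ∑ φ_{γ,δ} y_{α+γ,β+δ}`. -/
def shiftC {n : ℕ} (y : MIdx n → MIdx n → ℂ) (φ : CPoly n) (α β : MIdx n) : ℂ :=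
  ∑ κ ∈ φ.support, φ.coeff κ * y (α + antiExp κ) (β + holExp κ)

/-- The complex localizing matrix `M_d(φy)`, indexed by `|α|, |β| ≤ d`. -/
def locC {n : ℕ} (d : ℕ) (φ : CPoly n) (y : MIdx n → MIdx n → ℂ) :
    Matrix (MIdxLE n d) (MIdxLE n d) ℂ :=
  Matrix.of fun α β => shiftC y φ α.1 β.1

/-- The real part of `L_y(z̄^α z^β φ)` for `y = a + ib`, in real arithmetic. -/
def shiftRe {n : ℕ} (a b : MIdx n → MIdx n → ℝ) (φ : CPoly n) (α β : MIdx n) : ℝ :=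
  ∑ κ ∈ φ.support, ((φ.coeff κ).re * a (α + antiExp κ) (β + holExp κ) -
    (φ.coeff κ).im * b (α + antiExp κ) (β + holExp κ))

/-- The imaginary part of `L_y(z̄^α z^β φ)` for `y = a + ib`, in real arithmetic. -/
def shiftIm {n : ℕ} (a b : MIdx n → MIdx n → ℝ) (φ : CPoly n) (α β : MIdx n) : ℝ :=
  ∑ κ ∈ φ.support, ((φ.coeff κ).re * b (α + antiExp κ) (β + holExp κ) +
    (φ.coeff κ).im * a (α + antiExp κ) (β + holExp κ))

/-- The real matrix `[[Re M, -Im M], [Im M, Re M]]` of twice the size, where `M = M_d(φy)` and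
`y = a + ib`. -/
def locConv {n : ℕ} (d : ℕ) (φ : CPoly n) (a b : MIdx n → MIdx n → ℝ) :
    Matrix (MIdxLE n d ⊕ MIdxLE n d) (MIdxLE n d ⊕ MIdxLE n d) ℝ :=
  Matrix.fromBlocks
    (Matrix.of fun α β => shiftRe a b φ α.1 β.1) (Matrix.of fun α β => -shiftIm a b φ α.1 β.1)
    (Matrix.of fun α β => shiftIm a b φ α.1 β.1) (Matrix.of fun α β => shiftRe a b φ α.1 β.1)

/-- `L_y((x,y)^μ F) = ∑ F_κ y_{μ+κ}` for a real sequence `y` indexed by `ℕ²ⁿ`. -/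
def shiftR {n : ℕ} (y : (Fin n ⊕ Fin n →₀ ℕ) → ℝ) (F : RPoly n) (μ : Fin n ⊕ Fin n →₀ ℕ) : ℝ :=
  ∑ κ ∈ F.support, F.coeff κ * y (μ + κ)

/-- The real localizing matrix `M_d(Fy)`, indexed by `|μ|, |ν| ≤ d` in `ℕ²ⁿ`. -/
def locR {n : ℕ} (d : ℕ) (F : RPoly n) (y : (Fin n ⊕ Fin n →₀ ℕ) → ℝ) :
    Matrix {μ : Fin n ⊕ Fin n →₀ ℕ // μ.degree ≤ d} {μ : Fin n ⊕ Fin n →₀ ℕ // μ.degree ≤ d} ℝ :=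
  Matrix.of fun μ ν => shiftR y F (μ.1 + ν.1)

end CPOP

/-! ### Complex polynomial optimization and its relaxations -/

/-- The problem `inf f(z)` subject to `g_i(z) ≥ 0`, `i = 1, …, m`, over `z ∈ ℂⁿ`, with `f` and the
`g_i` real-valued complex polynomials. -/
structure ComplexPOP (n m : ℕ) where
  /-- the objective `f` -/
  obj : CPOP.CPoly n
  /-- the constraint functions `g_i` -/
  con : Fin m → CPOP.CPoly n
  obj_real : ∀ z, star (CPOP.evalC obj z) = CPOP.evalC obj z
  con_real : ∀ i z, star (CPOP.evalC (con i) z) = CPOP.evalC (con i) z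

namespace ComplexPOP

open CPOP

variable {n m : ℕ} (P : ComplexPOP n m)

/-- One of the constraints is a sphere constraint `|z_1|² + ⋯ + |z_n|² = R²` with `R > 0`, an
equality being enforced by two opposite inequalities. -/
def SphereAssumption : Prop :=
  ∃ R : ℝ, 0 < R ∧ (∃ i, P.con i = spherePoly n R) ∧ ∃ i, P.con i = -spherePoly n R

/-- The orders `k_i` of the constraints of the complex problem. -/
def conOrder (i : Fin m) : ℕ := order (P.con i)

/-- The half-degrees `⌈deg g̃_i / 2⌉` of the constraints of the real problem. -/
def conHalfDegree (i : Fin m) : ℕ := halfDegree (realify (P.con i))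

/-- The minimal order of the complex hierarchy. -/
def dminC : ℕ := max (order P.obj) (Finset.univ.sup P.conOrder)

/-- The minimal order of the real hierarchy of the problem converted into real numbers. -/
def dminR : ℕ := max (halfDegree (realify P.obj)) (Finset.univ.sup P.conHalfDegree)

/-- Value of the complex moment relaxation of order `d`: the infimum of `L_y(f)` over Hermitian `y`
with `y_{0,0} = 1`, `M_d(y) ≽ 0` and `M_{d-k_i}(g_i y) ≽ 0`.
For `d ≥ dminC` only the entries `y_{α,β}` with `|α|, |β| ≤ d` play a role. -/
def complexMomentValue (d : ℕ) : EReal :=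
  sInf {v | ∃ y : MIdx n → MIdx n → ℂ, (∀ α β, star (y α β) = y β α) ∧ y 0 0 = 1 ∧
    (locC d 1 y).PosSemidef ∧ (∀ i, (locC (d - P.conOrder i) (P.con i) y).PosSemidef) ∧
    v = (((shiftC y P.obj 0 0).re : ℝ) : EReal)}

/-- Value of the complex sum-of-squares relaxation of order `d`: the supremum of the `t ∈ ℝ` with
`f - t = σ_0 + ∑ σ_i g_i`, `σ_0 ∈ Σ_d[z]`, `σ_i ∈ Σ_{d-k_i}[z]`. -/
def complexSOSValue (d : ℕ) : EReal :=
  sSup {v | ∃ t : ℝ, (∃ σ₀ ∈ hermitianSOS n d, ∃ σ : Fin m → (Fin n → ℂ) → ℂ,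
    (∀ i, σ i ∈ hermitianSOS n (d - P.conOrder i)) ∧
    ∀ z, evalC P.obj z - (t : ℂ) = σ₀ z + ∑ i, σ i z * evalC (P.con i) z) ∧ v = (t : EReal)}

/-- Value of the conversion into real numbers of the complex moment relaxation of order `d`: the
complex variable `y = a + ib` is replaced by the pair of real variables `(a, b)`, and each Hermitian
constraint `M ≽ 0` by the real constraint `[[Re M, -Im M], [Im M, Re M]] ≽ 0`. -/
def convertedMomentValue (d : ℕ) : EReal :=
  sInf {v | ∃ a b : MIdx n → MIdx n → ℝ, (∀ α β, a α β = a β α) ∧ (∀ α β, b α β = -b β α) ∧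
    a 0 0 = 1 ∧ b 0 0 = 0 ∧
    (locConv d 1 a b).PosSemidef ∧
    (∀ i, (locConv (d - P.conOrder i) (P.con i) a b).PosSemidef) ∧
    v = ((shiftRe a b P.obj 0 0 : ℝ) : EReal)}

/-- Value of the conversion into real numbers of the complex sum-of-squares relaxation of order `d`:
the supremum of the `t ∈ ℝ` with `f̃ - t = σ_0 + ∑ σ_i g̃_i` on `ℝ²ⁿ`, `σ_0 ∈ Σ_d[x+iy]`,
`σ_i ∈ Σ_{d-k_i}[x+iy]`. -/
def convertedSOSValue (d : ℕ) : EReal :=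
  sSup {v | ∃ t : ℝ, (∃ σ₀ ∈ convertedSOS n d, ∃ σ : Fin m → (Fin n ⊕ Fin n → ℝ) → ℝ,
    (∀ i, σ i ∈ convertedSOS n (d - P.conOrder i)) ∧
    ∀ w, MvPolynomial.eval w (realify P.obj) - t =
      σ₀ w + ∑ i, σ i w * MvPolynomial.eval w (realify (P.con i))) ∧ v = (t : EReal)}

/-- Value of the real moment relaxation of order `d` of the problem converted into real numbers,
`inf f̃(x,y)` subject to `g̃_i(x,y) ≥ 0`: the infimum of `L_y(f̃)` over real `y` with `y_0 = 1`,
`M_d(y) ≽ 0` and `M_{d-e_i}(g̃_i y) ≽ 0`. In the Lasserre relaxation `e_i = ⌈deg g̃_i / 2⌉`.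
Only the entries of `y` of index at most `2d` in length play a role when `e_i ≥ ⌈deg g̃_i / 2⌉` and
`d ≥ dminR`, `d ≥ e_i`. -/
def realMomentValue (e : Fin m → ℕ) (d : ℕ) : EReal :=
  sInf {v | ∃ y : (Fin n ⊕ Fin n →₀ ℕ) → ℝ, y 0 = 1 ∧
    (locR d 1 y).PosSemidef ∧ (∀ i, (locR (d - e i) (realify (P.con i)) y).PosSemidef) ∧
    v = ((shiftR y (realify P.obj) 0 : ℝ) : EReal)}

/-- Value of the real sum-of-squares relaxation of order `d` of the problem converted into real
numbers: the supremum of the `t ∈ ℝ` with `f̃ - t = σ_0 + ∑ σ_i g̃_i` on `ℝ²ⁿ`, `σ_0 ∈ Σ_d[x,y]`,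
`σ_i ∈ Σ_{d-e_i}[x,y]`. In the Lasserre relaxation `e_i = ⌈deg g̃_i / 2⌉`. -/
def realSOSValue (e : Fin m → ℕ) (d : ℕ) : EReal :=
  sSup {v | ∃ t : ℝ, (∃ σ₀ ∈ realSOS n d, ∃ σ : Fin m → (Fin n ⊕ Fin n → ℝ) → ℝ,
    (∀ i, σ i ∈ realSOS n (d - e i)) ∧
    ∀ w, MvPolynomial.eval w (realify P.obj) - t =
      σ₀ w + ∑ i, σ i w * MvPolynomial.eval w (realify (P.con i))) ∧ v = (t : EReal)}

end ComplexPOP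

end

noncomputable section

/-! Each moment/sum-of-squares pair is closed by one conic argument. For fixed truncation degrees
the functions `σ₀ + ∑ σ_i g_i` form a cone `Q`, and the sum-of-squares value is the supremum of the
`t` with `f - t ∈ Q`. Weak duality is the application of `L_y` to such an identity.

For the converse, the sphere constraint makes the constant `1` an order unit: modulo `Q`, every
monomial within the truncation (in the complex case, the real part of every complex multiple of one)
lies between two multiples of `1`, with certificates that respect the degree bounds
(`re_monom_mem_boundedBy`, `monom_mem_boundedBy`). If `f - t ∉ Q`, the M. Riesz extension theorem
then gives a functional `L` with `L 1 = 1` and `L f ≤ t`, nonnegative on the bounded part of `Q`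
(`PointedCone.exists_state_le`). Its moments are feasible with value at most `t`. Closedness of `Q`
plays no role, since only values are compared and the supremum need not be attained. An infeasible
moment problem is covered too: every `t` is then representable and both values are `+∞`.

The comparison takes place on the sum-of-squares side. From `|p|² = (Re p)² + (Im p)²` and `⌈deg g̃
/ 2⌉ ≤ ord g`, a complex certificate is also a real one within the real degree bounds. Duality
carries the inequality over to the moment values. -/

/-- Equality of two extended-real optimal values from weak duality and from the alternative
"`t` is attained on the right, or beaten on the left". -/
theorem EReal.sInf_eq_sSup_of_duality {A B : Set ℝ} (weak : ∀ a ∈ A, ∀ t ∈ B, t ≤ a)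
    (strong : ∀ t ∉ B, ∃ a ∈ A, a ≤ t) :
    sInf ((fun x : ℝ => (x : EReal)) '' A) = sSup ((fun x : ℝ => (x : EReal)) '' B) := by
  apply le_antisymm
  · by_contra! h
    obtain ⟨t, h1, h2⟩ := EReal.lt_iff_exists_real_btwn.1 h
    by_cases ht : t ∈ B
    · exact absurd (le_sSup (Set.mem_image_of_mem _ ht)) (not_le.2 h1)
    · obtain ⟨a, ha, hat⟩ := strong t ht
      have := sInf_le (Set.mem_image_of_mem (fun x : ℝ => (x : EReal)) ha)
      exact absurd (this.trans (EReal.coe_le_coe_iff.2 hat)) (not_le.2 h2)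
  · refine sSup_le ?_
    rintro _ ⟨t, ht, rfl⟩
    refine le_sInf ?_
    rintro _ ⟨a, ha, rfl⟩
    exact EReal.coe_le_coe_iff.2 (weak a ha t ht)

/-! ### Order units and positive functionals -/

namespace PointedCone

variable {V : Type*} [AddCommGroup V] [Module ℝ V]

/-- The vectors that lie between two multiples of `e` in the order defined by the cone `Q`. -/
def boundedBy (Q : PointedCone ℝ V) (e : V) : Submodule ℝ V where
  carrier := {x | (∃ N : ℝ, N • e - x ∈ Q) ∧ ∃ N : ℝ, N • e + x ∈ Q}
  zero_mem' := ⟨⟨0, by simp⟩, ⟨0, by simp⟩⟩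
  add_mem' := by
    rintro x y ⟨⟨a, ha⟩, ⟨b, hb⟩⟩ ⟨⟨c, hc⟩, ⟨d, hd⟩⟩
    refine ⟨⟨a + c, ?_⟩, ⟨b + d, ?_⟩⟩
    · convert Q.add_mem ha hc using 1
      module
    · convert Q.add_mem hb hd using 1
      module
  smul_mem' := by
    rintro c x ⟨⟨a, ha⟩, ⟨b, hb⟩⟩
    rcases le_total 0 c with hc | hc
    · refine ⟨⟨c * a, ?_⟩, ⟨c * b, ?_⟩⟩
      · convert Q.smul_mem hc ha using 1
        module
      · convert Q.smul_mem hc hb using 1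
        module
    -- A negative scalar exchanges the upper and the lower bound.
    · have hc' : 0 ≤ -c := neg_nonneg.2 hc
      refine ⟨⟨-c * b, ?_⟩, ⟨-c * a, ?_⟩⟩
      · convert Q.smul_mem hc' hb using 1
        module
      · convert Q.smul_mem hc' ha using 1
        module

/-- If every vector is bounded by the element `e` of the cone `Q`, and `-e ∉ Q`, then there is a
positive functional normalized at `e`. -/
theorem exists_normalized_of_neg_notMem (Q : PointedCone ℝ V) {e : V}
    (hbd : ∀ x : V, ∃ N : ℝ, N • e + x ∈ Q) (hne : -e ∉ Q) :
    ∃ L : V →ₗ[ℝ] ℝ, (∀ x ∈ Q, 0 ≤ L x) ∧ L e = 1 := by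
  have he : e ≠ 0 := by
    rintro rfl
    exact hne (by simp)
  -- The functional `c • e ↦ c` on the line through `e` is extended. It is nonnegative on `Q` there,
  -- because `c • e ∈ Q` with `c < 0` would rescale to `-e ∈ Q`.
  obtain ⟨L, hL, hpos⟩ := riesz_extension Q (LinearPMap.mkSpanSingleton e (1 : ℝ) he) (by
    rintro ⟨x, hx⟩ hxQ
    obtain ⟨c, rfl⟩ := Submodule.mem_span_singleton.1 hx
    rw [LinearPMap.mkSpanSingleton'_apply]
    by_contra! hc
    simp only [RingHom.id_apply, smul_eq_mul, mul_one] at hc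
    apply hne
    have := Q.smul_mem (inv_nonneg.2 (neg_nonneg.2 hc.le)) hxQ
    rwa [smul_smul, inv_neg, neg_mul, inv_mul_cancel₀ hc.ne, neg_one_smul] at this) (by
    intro y
    obtain ⟨N, hN⟩ := hbd y
    exact ⟨⟨N • e, Submodule.mem_span_singleton.2 ⟨N, rfl⟩⟩, hN⟩)
  refine ⟨L, hpos, ?_⟩
  have := hL ⟨e, Submodule.mem_span_singleton_self e⟩
  rw [this]
  exact LinearPMap.mkSpanSingleton_apply ℝ ℝ he 1

/-- If `f` is bounded by the element `e` of the cone `Q` and `f - t e ∉ Q`, some functional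
normalized at `e` and positive on the bounded elements of `Q` takes a value at most `t` at `f`. -/
theorem exists_state_le (Q : PointedCone ℝ V) {e f : V} (he : e ∈ Q) (hf : f ∈ Q.boundedBy e)
    {t : ℝ} (ht : f - t • e ∉ Q) :
    ∃ L : V →ₗ[ℝ] ℝ, (∀ x ∈ Q, x ∈ Q.boundedBy e → 0 ≤ L x) ∧ L e = 1 ∧ L f ≤ t := by
  have heE : e ∈ Q.boundedBy e :=
    ⟨⟨1, by simp⟩, ⟨0, by simpa using he⟩⟩
  have hgE : t • e - f ∈ Q.boundedBy e := Submodule.sub_mem _ (Submodule.smul_mem _ _ heE) hf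
  let ι : Q.boundedBy e →ₗ[ℝ] V := (Q.boundedBy e).subtype
  -- Adjoining `t • e - f` to the cone is what forces `L f ≤ t`.
  let Q' : PointedCone ℝ (Q.boundedBy e) :=
    Q.comap ι ⊔ PointedCone.hull ℝ {(⟨t • e - f, hgE⟩ : Q.boundedBy e)}
  have hQQ' : ∀ x : Q.boundedBy e, (x : V) ∈ Q → x ∈ Q' := fun x hx =>
    Submodule.mem_sup_left (by simpa [ι] using hx)
  obtain ⟨L, hpos, hL⟩ := exists_normalized_of_neg_notMem Q' (e := ⟨e, heE⟩) (by
      intro x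
      obtain ⟨N, hN⟩ := x.2.2
      exact ⟨N, hQQ' _ (by simpa using hN)⟩) (by
    intro hmem
    obtain ⟨q, hq, r, hr, hqr⟩ := Submodule.mem_sup.1 hmem
    obtain ⟨⟨s, hs⟩, rfl⟩ := Submodule.mem_span_singleton.1 hr
    have hq' : (q : V) ∈ Q := by simpa [ι] using hq
    have h : (q : V) + s • (t • e - f) = -e := congrArg Subtype.val hqr
    -- If `-e ∈ Q`, then `Q` contains every bounded element, in particular `f - t • e`. Passing to
    -- `max 0 N` keeps both scalars nonnegative.
    have hne : -e ∉ Q := by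
      intro hne
      obtain ⟨N, hN⟩ := (Submodule.sub_mem _ hf (Submodule.smul_mem _ t heE)).2
      apply ht
      have h1 := Q.add_mem hN (Q.smul_mem (le_max_left 0 N) hne)
      have h2 := Q.add_mem h1 (Q.smul_mem (sub_nonneg.2 (le_max_right 0 N)) he)
      convert h2 using 1
      module
    -- For `s = 0` the relation says `-e = q ∈ Q`; for `s > 0` it says `s • (f - t • e) = q + e ∈
    -- Q`.
    rcases hs.eq_or_lt with h0 | h0
    · apply hne
      rw [← h, ← h0, zero_smul, add_zero]
      exact hq'
    · apply ht
      have h1 := Q.smul_mem (inv_nonneg.2 hs) (Q.add_mem hq' he)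
      have h2 : (q : V) + e = s • (f - t • e) := by
        rw [eq_sub_of_add_eq h]
        module
      rwa [h2, smul_smul, inv_mul_cancel₀ h0.ne', one_smul] at h1)
  -- The extension to all of `V` is arbitrary, so positivity survives only on bounded elements. It
  -- serves to define moments at every index, including those beyond the truncation.
  obtain ⟨L', hL'⟩ := LinearMap.exists_extend L
  have hext : ∀ x : Q.boundedBy e, L' x = L x := fun x => LinearMap.congr_fun hL' x
  refine ⟨L', fun x hx hxE => ?_, ?_, ?_⟩
  · rw [hext ⟨x, hxE⟩]
    exact hpos _ (hQQ' _ hx)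
  · rw [hext ⟨e, heE⟩, hL]
  · have h1 : 0 ≤ L ⟨t • e - f, hgE⟩ :=
      hpos _ (Submodule.mem_sup_right (Submodule.subset_span rfl))
    rw [← hext, map_sub, map_smul, hext ⟨e, heE⟩, hL] at h1
    simpa using h1

end PointedCone

/-! ### Cones of weighted sums of squares -/

/-- The functions `σ₀ + ∑ σ_i g_i` with `σ₀ ∈ S₀` and `σ_i ∈ S_i`. -/
def weightedCone {X : Type*} {m : ℕ} (S₀ : PointedCone ℝ (X → ℝ))
    (S : Fin m → PointedCone ℝ (X → ℝ)) (g : Fin m → X → ℝ) : PointedCone ℝ (X → ℝ) where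
  carrier := {F | ∃ σ₀ ∈ S₀, ∃ σ : Fin m → X → ℝ, (∀ i, σ i ∈ S i) ∧
    ∀ w, F w = σ₀ w + ∑ i, σ i w * g i w}
  zero_mem' := ⟨0, S₀.zero_mem, 0, fun i => (S i).zero_mem, by simp⟩
  add_mem' := by
    rintro F G ⟨σ₀, h₀, σ, hσ, hF⟩ ⟨τ₀, k₀, τ, hτ, hG⟩
    refine ⟨σ₀ + τ₀, S₀.add_mem h₀ k₀, σ + τ, fun i => (S i).add_mem (hσ i) (hτ i), fun w => ?_⟩
    simp only [Pi.add_apply, hF, hG, add_mul, Finset.sum_add_distrib]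
    ring
  smul_mem' := by
    rintro c F ⟨σ₀, h₀, σ, hσ, hF⟩
    refine ⟨c • σ₀, Submodule.smul_mem S₀ c h₀, c • σ, fun i => Submodule.smul_mem (S i) c (hσ i), fun w => ?_⟩
    simp only [Pi.smul_apply, hF, smul_add, Finset.smul_sum,
      smul_mul_assoc]

theorem mem_weightedCone_left {X : Type*} {m : ℕ} {S₀ : PointedCone ℝ (X → ℝ)}
    {S : Fin m → PointedCone ℝ (X → ℝ)} {g : Fin m → X → ℝ} {σ : X → ℝ} (hσ : σ ∈ S₀) :
    σ ∈ weightedCone S₀ S g :=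
  ⟨σ, hσ, 0, fun i => (S i).zero_mem, by simp⟩

theorem mem_weightedCone_mul {X : Type*} {m : ℕ} {S₀ : PointedCone ℝ (X → ℝ)}
    {S : Fin m → PointedCone ℝ (X → ℝ)} {g : Fin m → X → ℝ} (i : Fin m) {σ : X → ℝ}
    (hσ : σ ∈ S i) : σ * g i ∈ weightedCone S₀ S g := by
  classical
  refine ⟨0, S₀.zero_mem, Pi.single i σ, fun j => ?_, fun w => ?_⟩
  · rcases eq_or_ne j i with rfl | h
    · simpa using hσ
    · simp [Pi.single_eq_of_ne h]
  · rw [Finset.sum_eq_single i]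
    · simp
    · intro j _ h
      simp [Pi.single_eq_of_ne h]
    · simp

/-! ### Monomials and polynomials of bounded degree -/

namespace CPOP

variable {n : ℕ}

/-- The monomial `x ↦ x^α`. -/
def monom {ι R : Type*} [CommMonoid R] (α : ι →₀ ℕ) (x : ι → R) : R := α.prod fun i k => x i ^ k

theorem monom_add {ι R : Type*} [CommMonoid R] (α β : ι →₀ ℕ) (x : ι → R) :
    monom (α + β) x = monom α x * monom β x :=
  Finsupp.prod_add_index' (fun _ => pow_zero _) (fun _ _ _ => pow_add _ _ _)

@[simp]
theorem monom_zero {ι R : Type*} [CommMonoid R] (x : ι → R) : monom 0 x = 1 :=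
  Finsupp.prod_zero_index

@[simp]
theorem monom_single_one {ι R : Type*} [CommMonoid R] (i : ι) (x : ι → R) :
    monom (Finsupp.single i 1) x = x i := by
  simp [monom]

theorem exists_eq_add_single {ι : Type*} {α : ι →₀ ℕ} {k : ℕ} (h : α.degree = k + 1) :
    ∃ β i, β.degree = k ∧ α = β + Finsupp.single i 1 := by
  obtain ⟨i, hi⟩ : ∃ i, α i ≠ 0 := by
    by_contra! h0
    obtain rfl : α = 0 := Finsupp.ext h0
    simp at h
  have hα : α = α - Finsupp.single i 1 + Finsupp.single i 1 :=
    (tsub_add_cancel_of_le (Finsupp.single_le_iff.2 (Nat.one_le_iff_ne_zero.2 hi))).symm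
  refine ⟨_, i, ?_, hα⟩
  rw [hα, map_add, Finsupp.degree_single] at h
  omega

theorem eval_eq_sum_monom {ι R : Type*} [CommSemiring R] (p : MvPolynomial ι R) (x : ι → R) :
    MvPolynomial.eval x p = ∑ κ ∈ p.support, p.coeff κ * monom κ x :=
  MvPolynomial.eval_eq x p

instance {ι : Type*} [Finite ι] (d : ℕ) : Fintype {α : ι →₀ ℕ // α.degree ≤ d} :=
  @Fintype.ofFinite _ (Finsupp.finite_of_degree_le d)

theorem totalDegree_le_iff {ι R : Type*} [CommSemiring R] {p : MvPolynomial ι R} {d : ℕ} :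
    p.totalDegree ≤ d ↔ ∀ α ∈ p.support, α.degree ≤ d :=
  Finset.sup_le_iff

theorem eval_eq_sum_of_totalDegree_le {ι R : Type*} [Finite ι] [CommSemiring R]
    {p : MvPolynomial ι R} {d : ℕ} (hp : p.totalDegree ≤ d) (x : ι → R) :
    MvPolynomial.eval x p = ∑ α : {α : ι →₀ ℕ // α.degree ≤ d}, p.coeff α.1 * monom α.1 x := by
  classical
  rw [eval_eq_sum_monom]
  refine Finset.sum_bij_ne_zero (fun α h _ => ⟨α, totalDegree_le_iff.1 hp α h⟩) ?_ ?_ ?_ ?_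
  · simp
  · intro a _ _ b _ _ h
    exact congrArg Subtype.val h
  · intro b _ hb
    exact ⟨b.1, MvPolynomial.mem_support_iff.2 (left_ne_zero_of_mul hb), hb, rfl⟩
  · intros
    rfl

/-- The polynomial `∑ x_α X^α` over `|α| ≤ d`. -/
def polyOfCoeff {ι R : Type*} [Finite ι] [CommSemiring R] {d : ℕ}
    (x : {α : ι →₀ ℕ // α.degree ≤ d} → R) : MvPolynomial ι R :=
  ∑ α, MvPolynomial.monomial α.1 (x α)

theorem totalDegree_polyOfCoeff {ι R : Type*} [Finite ι] [CommSemiring R] {d : ℕ}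
    (x : {α : ι →₀ ℕ // α.degree ≤ d} → R) : (polyOfCoeff x).totalDegree ≤ d :=
  MvPolynomial.totalDegree_finsetSum_le fun α _ =>
    (MvPolynomial.totalDegree_monomial_le _ _).trans α.2

theorem eval_polyOfCoeff {ι R : Type*} [Finite ι] [CommSemiring R] {d : ℕ}
    (x : {α : ι →₀ ℕ // α.degree ≤ d} → R) (v : ι → R) :
    MvPolynomial.eval v (polyOfCoeff x) = ∑ α, x α * monom α.1 v := by
  simp [polyOfCoeff, MvPolynomial.eval_monomial, monom]

/-! ### Complex coordinates and real coordinates -/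

/-- The point `x + iy` of `ℂⁿ`. -/
def toComplexPoint (w : Fin n ⊕ Fin n → ℝ) : Fin n → ℂ :=
  fun l => (w (Sum.inl l) : ℂ) + Complex.I * w (Sum.inr l)

theorem toComplexPoint_surjective (z : Fin n → ℂ) : ∃ w, toComplexPoint w = z :=
  ⟨Sum.elim (fun l => (z l).re) fun l => (z l).im, by
    ext l
    simp [toComplexPoint, mul_comm Complex.I, Complex.re_add_im]⟩

/-- The substitution `z̄ = x - iy`, `z = x + iy`. -/
def realSubst : CPoly n →ₐ[ℂ] CPoly n :=
  MvPolynomial.aeval (Sum.elim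
    (fun j => MvPolynomial.X (Sum.inl j) - MvPolynomial.C Complex.I * MvPolynomial.X (Sum.inr j))
    (fun j => MvPolynomial.X (Sum.inl j) + MvPolynomial.C Complex.I * MvPolynomial.X (Sum.inr j)))

/-- The substitution `x = (z + z̄) / 2`, `y = (z - z̄) / 2i`. -/
def complexSubst : CPoly n →ₐ[ℂ] CPoly n :=
  MvPolynomial.aeval (Sum.elim
    (fun j => MvPolynomial.C (1 / 2) * (MvPolynomial.X (Sum.inr j) + MvPolynomial.X (Sum.inl j)))
    (fun j => MvPolynomial.C (-Complex.I / 2) *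
      (MvPolynomial.X (Sum.inr j) - MvPolynomial.X (Sum.inl j))))

theorem complexSubst_realSubst (φ : CPoly n) : complexSubst (realSubst φ) = φ := by
  suffices h : (complexSubst (n := n)).comp realSubst = AlgHom.id ℂ _ from AlgHom.congr_fun h φ
  have h2 : (MvPolynomial.C (1 / 2 : ℂ) : CPoly n) * 2 = 1 := by
    rw [← map_ofNat (MvPolynomial.C (σ := Fin n ⊕ Fin n) (R := ℂ)) 2, ← map_mul]
    norm_num
  have hI : (MvPolynomial.C Complex.I : CPoly n) * MvPolynomial.C (-Complex.I / 2) =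
      MvPolynomial.C (1 / 2 : ℂ) := by
    rw [← map_mul, mul_div_assoc', mul_neg, Complex.I_mul_I, neg_neg]
  ext (j | j) : 1
  · simp only [realSubst, complexSubst, AlgHom.comp_apply, MvPolynomial.aeval_X, Sum.elim_inl,
      map_sub, map_mul, MvPolynomial.algHom_C, Sum.elim_inr, MvPolynomial.algebraMap_eq,
      AlgHom.id_apply]
    linear_combination (MvPolynomial.X (Sum.inl j)) * h2 -
      (MvPolynomial.X (Sum.inr j) - MvPolynomial.X (Sum.inl j)) * hI
  · simp only [realSubst, complexSubst, AlgHom.comp_apply, MvPolynomial.aeval_X, Sum.elim_inl,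
      map_add, map_mul, MvPolynomial.algHom_C, Sum.elim_inr, MvPolynomial.algebraMap_eq,
      AlgHom.id_apply]
    linear_combination (MvPolynomial.X (Sum.inr j)) * h2 +
      (MvPolynomial.X (Sum.inr j) - MvPolynomial.X (Sum.inl j)) * hI

theorem eval_realSubst (φ : CPoly n) (w : Fin n ⊕ Fin n → ℝ) :
    MvPolynomial.eval (fun s => (w s : ℂ)) (realSubst φ) = evalC φ (toComplexPoint w) := by
  suffices h : (MvPolynomial.aeval fun s => (w s : ℂ)).comp (realSubst (n := n)) =
      MvPolynomial.aeval (Sum.elim (fun j => star (toComplexPoint w j)) (toComplexPoint w)) from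
    AlgHom.congr_fun h φ
  ext (j | j) : 1
  · simp [realSubst, toComplexPoint, sub_eq_add_neg]
  · simp [realSubst, toComplexPoint]

/-- The change of variables is invertible, and a polynomial is determined by its values on the real
points, a product of infinite sets. This turns identities between functions into identities between
coefficients, on which `L_y` acts. -/
theorem eq_of_evalC_eq {φ ψ : CPoly n}
    (h : ∀ w, evalC φ (toComplexPoint w) = evalC ψ (toComplexPoint w)) : φ = ψ := by
  rw [← complexSubst_realSubst φ, ← complexSubst_realSubst ψ]
  congr 1
  refine MvPolynomial.funext_set (fun _ => Set.range ((↑) : ℝ → ℂ))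
    (fun _ => Set.infinite_range_of_injective Complex.ofReal_injective) fun x hx => ?_
  choose w hw using fun i => hx i trivial
  obtain rfl : (fun s => (w s : ℂ)) = x := funext hw
  rw [eval_realSubst, eval_realSubst, h]

theorem monom_ofReal {ι : Type*} (κ : ι →₀ ℕ) (w : ι → ℝ) :
    monom κ (fun s => (w s : ℂ)) = ((monom κ w : ℝ) : ℂ) := by
  simp [monom, Finsupp.prod]

/-- Monomials are real at real points, so taking real parts of coefficients commutes with evaluation
there. -/
theorem eval_realify (φ : CPoly n) (w : Fin n ⊕ Fin n → ℝ) :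
    MvPolynomial.eval w (realify φ) = (evalC φ (toComplexPoint w)).re := by
  rw [← eval_realSubst, eval_eq_sum_monom (realSubst φ), Complex.re_sum]
  change MvPolynomial.eval w (∑ κ ∈ (realSubst φ).support,
    MvPolynomial.monomial κ ((realSubst φ).coeff κ).re) = _
  simp only [map_sum, MvPolynomial.eval_monomial, monom_ofReal, Complex.re_mul_ofReal]
  rfl

theorem totalDegree_realSubst_le (φ : CPoly n) : (realSubst φ).totalDegree ≤ φ.totalDegree := by
  have hlin : ∀ s, (Sum.elim
      (fun j => MvPolynomial.X (Sum.inl j) - MvPolynomial.C Complex.I * MvPolynomial.X (Sum.inr j))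
      (fun j => MvPolynomial.X (Sum.inl j) + MvPolynomial.C Complex.I * MvPolynomial.X (Sum.inr j))
      s : CPoly n).totalDegree ≤ 1 := by
    have h : ∀ j : Fin n, (MvPolynomial.C Complex.I * MvPolynomial.X (Sum.inr j) :
        CPoly n).totalDegree ≤ 1 := fun j =>
      (MvPolynomial.totalDegree_mul _ _).trans (by simp)
    rintro (j | j)
    · exact (MvPolynomial.totalDegree_sub _ _).trans (max_le (by simp) (h j))
    · exact (MvPolynomial.totalDegree_add _ _).trans (max_le (by simp) (h j))
  rw [realSubst, MvPolynomial.aeval_def, MvPolynomial.eval₂_eq]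
  refine MvPolynomial.totalDegree_finsetSum_le fun κ hκ => ?_
  refine (MvPolynomial.totalDegree_mul _ _).trans ?_
  rw [MvPolynomial.algebraMap_eq, MvPolynomial.totalDegree_C, zero_add]
  refine (MvPolynomial.totalDegree_finsetProd _ _).trans ?_
  refine le_trans (Finset.sum_le_sum fun s _ => ?_) (MvPolynomial.le_totalDegree hκ)
  refine (MvPolynomial.totalDegree_pow _ _).trans ?_
  simpa using Nat.mul_le_mul_left (κ s) (hlin s)

theorem totalDegree_realify_le (φ : CPoly n) : (realify φ).totalDegree ≤ φ.totalDegree := by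
  refine le_trans ?_ (totalDegree_realSubst_le φ)
  change (∑ κ ∈ (realSubst φ).support,
    MvPolynomial.monomial κ ((realSubst φ).coeff κ).re : RPoly n).totalDegree ≤ _
  exact MvPolynomial.totalDegree_finsetSum_le fun κ hκ =>
    (MvPolynomial.totalDegree_monomial_le _ _).trans (MvPolynomial.le_totalDegree hκ)

/-! ### The order of a complex polynomial -/

@[simp]
theorem sumElim_antiExp_holExp (κ : Fin n ⊕ Fin n →₀ ℕ) :
    Finsupp.sumElim (antiExp κ) (holExp κ) = κ :=
  Finsupp.sumFinsuppEquivProdFinsupp.symm_apply_apply κ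

@[simp]
theorem antiExp_sumElim (α β : MIdx n) : antiExp (Finsupp.sumElim α β) = α :=
  congrArg Prod.fst (Finsupp.sumFinsuppEquivProdFinsupp.apply_symm_apply (α, β))

@[simp]
theorem holExp_sumElim (α β : MIdx n) : holExp (Finsupp.sumElim α β) = β :=
  congrArg Prod.snd (Finsupp.sumFinsuppEquivProdFinsupp.apply_symm_apply (α, β))

theorem antiExp_add (κ μ : Fin n ⊕ Fin n →₀ ℕ) : antiExp (κ + μ) = antiExp κ + antiExp μ :=
  congrArg Prod.fst (Finsupp.sumFinsuppAddEquivProdFinsupp.map_add κ μ)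

theorem holExp_add (κ μ : Fin n ⊕ Fin n →₀ ℕ) : holExp (κ + μ) = holExp κ + holExp μ :=
  congrArg Prod.snd (Finsupp.sumFinsuppAddEquivProdFinsupp.map_add κ μ)

theorem degree_eq_antiExp_add_holExp (κ : Fin n ⊕ Fin n →₀ ℕ) :
    κ.degree = (antiExp κ).degree + (holExp κ).degree := by
  simp only [Finsupp.degree_eq_sum, Fintype.sum_sum_type]
  rfl

theorem monom_sumElim (κ : Fin n ⊕ Fin n →₀ ℕ) (z : Fin n → ℂ) :
    monom κ (Sum.elim (fun j => star (z j)) z) =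
      star (monom (antiExp κ) z) * monom (holExp κ) z := by
  conv_lhs => rw [← sumElim_antiExp_holExp κ]
  rw [monom, Finsupp.prod_sumElim]
  simp [monom, Finsupp.prod]

theorem evalC_eq_sum (φ : CPoly n) (z : Fin n → ℂ) :
    evalC φ z = ∑ κ ∈ φ.support,
      φ.coeff κ * (star (monom (antiExp κ) z) * monom (holExp κ) z) := by
  simp only [evalC, eval_eq_sum_monom, monom_sumElim]

theorem order_le_iff {φ : CPoly n} {d : ℕ} :
    order φ ≤ d ↔ ∀ κ ∈ φ.support, (antiExp κ).degree ≤ d ∧ (holExp κ).degree ≤ d := by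
  simp only [order, Finset.sup_le_iff, max_le_iff]

theorem totalDegree_le_two_mul_order (φ : CPoly n) : φ.totalDegree ≤ 2 * order φ := by
  rw [totalDegree_le_iff]
  intro κ hκ
  have := order_le_iff.1 le_rfl κ hκ
  rw [degree_eq_antiExp_add_holExp]
  omega

/-- The substitution is linear, so it does not raise the degree, and `z̄^α z^β` has degree `|α| +
|β| ≤ 2 ord φ`. Hence real multipliers are allowed at least the degree of the complex ones. -/
theorem halfDegree_realify_le_order (φ : CPoly n) : halfDegree (realify φ) ≤ order φ := by
  have := totalDegree_realify_le φ
  have := totalDegree_le_two_mul_order φ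
  unfold halfDegree
  omega

theorem totalDegree_le_two_mul_halfDegree (F : RPoly n) : F.totalDegree ≤ 2 * halfDegree F := by
  unfold halfDegree
  omega

theorem order_spherePoly_le (n : ℕ) (R : ℝ) : order (spherePoly n R) ≤ 1 := by
  classical
  rw [order_le_iff]
  intro κ hκ
  rcases Finset.mem_union.1 (MvPolynomial.support_sub _ _ _ hκ) with h | h
  · rw [MvPolynomial.C_apply] at h
    have := Finset.mem_singleton.1 (MvPolynomial.support_monomial_subset h)
    subst this
    simp [antiExp, holExp]
  · obtain ⟨j, -, hj⟩ := Finset.mem_biUnion.1 (MvPolynomial.support_sum h)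
    have hX : (MvPolynomial.X (Sum.inl j) * MvPolynomial.X (Sum.inr j) : CPoly n) =
        MvPolynomial.monomial (Finsupp.sumElim (Finsupp.single j 1) (Finsupp.single j 1)) 1 := by
      simp [MvPolynomial.X, MvPolynomial.monomial_mul]
    rw [hX] at hj
    have := Finset.mem_singleton.1 (MvPolynomial.support_monomial_subset hj)
    subst this
    rw [antiExp_sumElim, holExp_sumElim]
    simp

end CPOP

/-! ### Hermitian matrices as real matrices of twice the size -/

open Matrix in
/-- A Hermitian matrix is positive semidefinite exactly when its conversion into a real matrix of
twice the size is. -/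
theorem Matrix.posSemidef_iff_fromBlocks_re_im {ι : Type*} [Fintype ι] (M : Matrix ι ι ℂ) :
    M.PosSemidef ↔ (Matrix.fromBlocks (Matrix.of fun i j => (M i j).re)
      (Matrix.of fun i j => -(M i j).im) (Matrix.of fun i j => (M i j).im)
      (Matrix.of fun i j => (M i j).re)).PosSemidef := by
  -- This holds for any `M`, with `x = u + iv`. Hermitian symmetry is needed only to make the
  -- imaginary part of `x* M x` vanish.
  have hre : ∀ u v : ι → ℝ, (star (fun i => (⟨u i, v i⟩ : ℂ)) ⬝ᵥ
      (M *ᵥ fun i => (⟨u i, v i⟩ : ℂ))).re =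
      star (Sum.elim u v) ⬝ᵥ ((Matrix.fromBlocks (Matrix.of fun i j => (M i j).re)
      (Matrix.of fun i j => -(M i j).im) (Matrix.of fun i j => (M i j).im)
      (Matrix.of fun i j => (M i j).re)) *ᵥ Sum.elim u v) := by
    intro u v
    simp only [dotProduct, mulVec, Fintype.sum_sum_type, Finset.mul_sum, Complex.re_sum,
      ← Finset.sum_add_distrib, mul_add, Pi.star_apply, Sum.elim_inl, Sum.elim_inr,
      Matrix.fromBlocks_apply₁₁, Matrix.fromBlocks_apply₁₂, Matrix.fromBlocks_apply₂₁,
      Matrix.fromBlocks_apply₂₂, Matrix.of_apply]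
    refine Finset.sum_congr rfl fun i _ => Finset.sum_congr rfl fun j _ => ?_
    simp
    ring
  have hherm : M.IsHermitian ↔ (Matrix.fromBlocks (Matrix.of fun i j => (M i j).re)
      (Matrix.of fun i j => -(M i j).im) (Matrix.of fun i j => (M i j).im)
      (Matrix.of fun i j => (M i j).re)).IsHermitian := by
    simp only [Matrix.IsHermitian.ext_iff, Sum.forall, Matrix.fromBlocks_apply₁₁,
      Matrix.fromBlocks_apply₁₂, Matrix.fromBlocks_apply₂₁, Matrix.fromBlocks_apply₂₂,
      Matrix.of_apply, star_trivial, Complex.ext_iff, Complex.star_def, Complex.conj_re,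
      Complex.conj_im]
    constructor
    · intro h
      exact ⟨fun i => ⟨fun j => (h i j).1, fun j => by rw [← (h i j).2, neg_neg]⟩,
        fun i => ⟨fun j => (h i j).2, fun j => (h i j).1⟩⟩
    · intro h i j
      exact ⟨(h.1 i).1 j, (h.2 i).1 j⟩
  rw [Matrix.posSemidef_iff_dotProduct_mulVec, Matrix.posSemidef_iff_dotProduct_mulVec]
  constructor
  · rintro ⟨h, hpos⟩
    refine ⟨hherm.1 h, fun x => ?_⟩
    have := (Complex.nonneg_iff.1 (hpos fun i => ⟨x (Sum.inl i), x (Sum.inr i)⟩)).1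
    rwa [hre, show Sum.elim (fun i => x (Sum.inl i)) (fun i => x (Sum.inr i)) = x from
      Sum.elim_comp_inl_inr x] at this
  · rintro ⟨h, hpos⟩
    refine ⟨hherm.2 h, fun x => Complex.nonneg_iff.2 ⟨?_, ?_⟩⟩
    · have := hpos (Sum.elim (fun i => (x i).re) fun i => (x i).im)
      rwa [← hre] at this
    · exact ((hherm.2 h).im_star_dotProduct_mulVec_self x).symm

namespace CPOP

variable {n : ℕ}

/-! ### The cones of sums of squares -/

/-- `convertedSOS` as a pointed cone. -/
def convertedSOSCone (n d : ℕ) : PointedCone ℝ ((Fin n ⊕ Fin n → ℝ) → ℝ) where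
  carrier := convertedSOS n d
  zero_mem' := ⟨0, Fin.elim0, fun j => j.elim0, by simp⟩
  add_mem' := by
    rintro F G ⟨r, p, hp, hF⟩ ⟨s, q, hq, hG⟩
    refine ⟨r + s, Fin.append p q, fun j => ?_, fun v => ?_⟩
    · refine Fin.addCases (fun i => ?_) (fun i => ?_) j
      · rw [Fin.append_left]
        exact hp i
      · rw [Fin.append_right]
        exact hq i
    · simp [Fin.sum_univ_add, hF, hG]
  smul_mem' := by
    rintro ⟨c, hc⟩ F ⟨r, p, hp, hF⟩
    refine ⟨r, fun j => MvPolynomial.C ((√c : ℝ) : ℂ) * p j, fun j => ?_, fun v => ?_⟩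
    · refine (MvPolynomial.totalDegree_mul _ _).trans ?_
      rw [MvPolynomial.totalDegree_C, zero_add]
      exact hp j
    · simp only [map_mul, MvPolynomial.eval_C, Complex.normSq_ofReal, Real.mul_self_sqrt hc,
        ← Finset.mul_sum, ← hF]
      rfl

/-- `realSOS` as a pointed cone. -/
def realSOSCone (n d : ℕ) : PointedCone ℝ ((Fin n ⊕ Fin n → ℝ) → ℝ) where
  carrier := realSOS n d
  zero_mem' := ⟨0, Fin.elim0, fun j => j.elim0, by simp⟩
  add_mem' := by
    rintro F G ⟨r, p, hp, hF⟩ ⟨s, q, hq, hG⟩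
    refine ⟨r + s, Fin.append p q, fun j => ?_, fun v => ?_⟩
    · refine Fin.addCases (fun i => ?_) (fun i => ?_) j
      · rw [Fin.append_left]
        exact hp i
      · rw [Fin.append_right]
        exact hq i
    · simp [Fin.sum_univ_add, hF, hG]
  smul_mem' := by
    rintro ⟨c, hc⟩ F ⟨r, p, hp, hF⟩
    refine ⟨r, fun j => MvPolynomial.C (√c) * p j, fun j => ?_, fun v => ?_⟩
    · refine (MvPolynomial.totalDegree_mul _ _).trans ?_
      rw [MvPolynomial.totalDegree_C, zero_add]
      exact hp j
    · simp only [map_mul, MvPolynomial.eval_C, mul_pow, Real.sq_sqrt hc,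
        ← Finset.mul_sum, ← hF]
      rfl

theorem normSq_mem_convertedSOSCone {d : ℕ} {p : MvPolynomial (Fin n) ℂ} (hp : p.totalDegree ≤ d) :
    (fun w => Complex.normSq (MvPolynomial.eval (toComplexPoint w) p)) ∈ convertedSOSCone n d :=
  ⟨1, fun _ => p, fun _ => hp, fun w => by simp; rfl⟩

theorem sq_mem_realSOSCone {d : ℕ} {q : RPoly n} (hq : q.totalDegree ≤ d) :
    (fun w => MvPolynomial.eval w q ^ 2) ∈ realSOSCone n d :=
  ⟨1, fun _ => q, fun _ => hq, fun w => by simp⟩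

theorem realSOS_mono {d e : ℕ} (h : d ≤ e) : realSOS n d ⊆ realSOS n e := by
  rintro σ ⟨r, q, hq, hσ⟩
  exact ⟨r, q, fun j => (hq j).trans h, hσ⟩

/-- `|p|² = (Re p)² + (Im p)²`, where both parts are real polynomials in `(x, y)` of degree at most
`deg p`. -/
theorem normSq_mem_realSOSCone {d : ℕ} {p : MvPolynomial (Fin n) ℂ} (hp : p.totalDegree ≤ d) :
    (fun w => Complex.normSq (MvPolynomial.eval (toComplexPoint w) p)) ∈ realSOSCone n d := by
  have hev : ∀ z, evalC (MvPolynomial.rename Sum.inr p) z = MvPolynomial.eval z p := fun z => by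
    rw [evalC, MvPolynomial.eval_rename]
    rfl
  have h1 : (realify (MvPolynomial.rename Sum.inr p)).totalDegree ≤ d :=
    (totalDegree_realify_le _).trans ((MvPolynomial.totalDegree_rename_le _ _).trans hp)
  -- The imaginary part is obtained from `realify` as `Im p = Re (-i p)`.
  have h2 : (realify (MvPolynomial.C (-Complex.I) *
      MvPolynomial.rename Sum.inr p)).totalDegree ≤ d := by
    refine (totalDegree_realify_le _).trans ((MvPolynomial.totalDegree_mul _ _).trans ?_)
    rw [MvPolynomial.totalDegree_C, zero_add]
    exact (MvPolynomial.totalDegree_rename_le _ _).trans hp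
  convert (realSOSCone n d).add_mem (sq_mem_realSOSCone h1) (sq_mem_realSOSCone h2) using 1
  ext w
  have h3 : evalC (MvPolynomial.C (-Complex.I) * MvPolynomial.rename Sum.inr p)
      (toComplexPoint w) = -Complex.I * MvPolynomial.eval (toComplexPoint w) p := by
    rw [← hev]
    simp [evalC]
  simp only [Pi.add_apply, eval_realify, hev, h3, Complex.normSq_apply]
  simp
  ring

theorem convertedSOS_subset_realSOS (n d : ℕ) : convertedSOS n d ⊆ realSOS n d := by
  rintro σ ⟨r, p, hp, hσ⟩
  have := Submodule.sum_mem (realSOSCone n d) (t := Finset.univ)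
    fun j _ => normSq_mem_realSOSCone (hp j)
  have hσ' : σ = ∑ j, fun w => Complex.normSq (MvPolynomial.eval (toComplexPoint w) (p j)) := by
    ext w
    rw [hσ, Finset.sum_apply]
    rfl
  rw [hσ']
  exact this

theorem ofReal_comp_mem_hermitianSOS_iff {d : ℕ} {σ : (Fin n ⊕ Fin n → ℝ) → ℝ}
    {τ : (Fin n → ℂ) → ℂ} (h : ∀ w, τ (toComplexPoint w) = σ w) :
    τ ∈ hermitianSOS n d ↔ σ ∈ convertedSOS n d := by
  refine exists_congr fun r => exists_congr fun p => and_congr_right fun _ => ?_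
  constructor
  · intro hτ w
    have := hτ (toComplexPoint w)
    rw [h] at this
    exact_mod_cast this
  · intro hσ z
    obtain ⟨w, rfl⟩ := toComplexPoint_surjective z
    rw [h, hσ]
    push_cast
    rfl

theorem shiftC_eq (a b : MIdx n → MIdx n → ℝ) (φ : CPoly n) (α β : MIdx n) :
    shiftC (fun α β => ⟨a α β, b α β⟩) φ α β = ⟨shiftRe a b φ α β, shiftIm a b φ α β⟩ := by
  apply Complex.ext
  · simp [shiftC, shiftRe]
  · simp [shiftC, shiftIm]

theorem posSemidef_locC_iff (d : ℕ) (φ : CPoly n) (a b : MIdx n → MIdx n → ℝ) :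
    (locC d φ fun α β => ⟨a α β, b α β⟩).PosSemidef ↔ (locConv d φ a b).PosSemidef := by
  rw [Matrix.posSemidef_iff_fromBlocks_re_im]
  simp only [locC, locConv, shiftC_eq, Matrix.of_apply]

end CPOP

/-! ### Conversion into real numbers and comparison of the sum-of-squares values -/

namespace ComplexPOP

open CPOP

variable {n m : ℕ} (P : ComplexPOP n m)

theorem evalC_obj (w : Fin n ⊕ Fin n → ℝ) :
    evalC P.obj (toComplexPoint w) = (MvPolynomial.eval w (realify P.obj) : ℝ) := by
  rw [eval_realify]
  exact (Complex.conj_eq_iff_re.1 (P.obj_real _)).symm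

theorem evalC_con (i : Fin m) (w : Fin n ⊕ Fin n → ℝ) :
    evalC (P.con i) (toComplexPoint w) = (MvPolynomial.eval w (realify (P.con i)) : ℝ) := by
  rw [eval_realify]
  exact (Complex.conj_eq_iff_re.1 (P.con_real i _)).symm

theorem complexMomentValue_eq_convertedMomentValue (d : ℕ) :
    P.complexMomentValue d = P.convertedMomentValue d := by
  rw [complexMomentValue, convertedMomentValue]
  congr 1
  ext v
  constructor
  · rintro ⟨y, hy, h0, hM, hg, rfl⟩
    obtain ⟨a, b, rfl⟩ : ∃ a b : MIdx n → MIdx n → ℝ, y = fun α β => ⟨a α β, b α β⟩ :=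
      ⟨fun α β => (y α β).re, fun α β => (y α β).im, rfl⟩
    refine ⟨a, b, fun α β => (congrArg Complex.re (hy β α)).symm, fun α β => ?_,
      congrArg Complex.re h0, congrArg Complex.im h0, (posSemidef_locC_iff _ _ _ _).1 hM,
      fun i => (posSemidef_locC_iff _ _ _ _).1 (hg i), by rw [shiftC_eq]⟩
    exact (congrArg Complex.im (hy β α)).symm
  · rintro ⟨a, b, ha, hb, ha0, hb0, hM, hg, rfl⟩
    refine ⟨fun α β => ⟨a α β, b α β⟩, fun α β => Complex.ext (ha α β) ?_, Complex.ext ha0 hb0,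
      (posSemidef_locC_iff _ _ _ _).2 hM, fun i => (posSemidef_locC_iff _ _ _ _).2 (hg i),
      by rw [shiftC_eq]⟩
    exact (hb β α).symm

theorem complexSOSValue_eq_convertedSOSValue (d : ℕ) :
    P.complexSOSValue d = P.convertedSOSValue d := by
  rw [complexSOSValue, convertedSOSValue]
  congr 1
  ext v
  refine exists_congr fun t => and_congr_left fun _ => ?_
  constructor
  · rintro ⟨σ₀, h₀, σ, hσ, h⟩
    -- Multipliers are complex-valued functions here, but sums of squared moduli take real values,
    -- so nothing is lost in passing to real parts.
    have hre : ∀ {e : ℕ} {τ : (Fin n → ℂ) → ℂ}, τ ∈ hermitianSOS n e →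
        ∀ w, τ (toComplexPoint w) = ((τ (toComplexPoint w)).re : ℝ) := by
      rintro e τ ⟨r, p, -, hτ⟩ w
      rw [hτ]
      norm_cast
    refine ⟨fun w => (σ₀ (toComplexPoint w)).re,
      (ofReal_comp_mem_hermitianSOS_iff (hre h₀)).1 h₀,
      fun i w => (σ i (toComplexPoint w)).re,
      fun i => (ofReal_comp_mem_hermitianSOS_iff (hre (hσ i))).1 (hσ i), fun w => ?_⟩
    have hw := h (toComplexPoint w)
    rw [hre h₀ w] at hw
    rw [P.evalC_obj, Finset.sum_congr rfl fun i _ => by rw [hre (hσ i) w, P.evalC_con]] at hw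
    exact_mod_cast hw
  · rintro ⟨σ₀, h₀, σ, hσ, h⟩
    let ρ : (Fin n → ℂ) → Fin n ⊕ Fin n → ℝ := fun z =>
      Sum.elim (fun l => (z l).re) fun l => (z l).im
    have hρ : ∀ w, ρ (toComplexPoint w) = w := fun w => by
      ext (l | l) <;> simp [ρ, toComplexPoint]
    refine ⟨fun z => σ₀ (ρ z), (ofReal_comp_mem_hermitianSOS_iff (fun w => by simp only [hρ])).2 h₀,
      fun i z => σ i (ρ z),
      fun i => (ofReal_comp_mem_hermitianSOS_iff (fun w => by simp only [hρ])).2 (hσ i), fun z => ?_⟩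
    obtain ⟨w, rfl⟩ := toComplexPoint_surjective z
    simp only [P.evalC_obj, P.evalC_con, hρ]
    exact_mod_cast h w

theorem convertedSOSValue_le_realSOSValue {e : Fin m → ℕ} (he : ∀ i, e i ≤ P.conOrder i) (d : ℕ) :
    P.convertedSOSValue d ≤ P.realSOSValue e d := by
  refine sSup_le_sSup ?_
  rintro v ⟨t, ⟨σ₀, h₀, σ, hσ, h⟩, rfl⟩
  exact ⟨t, ⟨σ₀, convertedSOS_subset_realSOS _ _ h₀, σ, fun i =>
    realSOS_mono (Nat.sub_le_sub_left (he i) d) (convertedSOS_subset_realSOS _ _ (hσ i)), h⟩, rfl⟩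

end ComplexPOP

/-! ### Complex moments: functionals and sequences -/

/-- The complex-linear extension of a real functional to complex-valued functions. -/
def LinearMap.complexExtend {X : Type*} (L : (X → ℝ) →ₗ[ℝ] ℝ) : (X → ℂ) →ₗ[ℂ] ℂ where
  toFun F := ⟨L fun w => (F w).re, L fun w => (F w).im⟩
  map_add' F G := Complex.ext (L.map_add _ _) (L.map_add _ _)
  map_smul' c F := by
    have hre : (fun w => ((c • F) w).re) =
        c.re • (fun w => (F w).re) - c.im • (fun w => (F w).im) := by
      ext w
      simp
    have him : (fun w => ((c • F) w).im) =
        c.re • (fun w => (F w).im) + c.im • (fun w => (F w).re) := by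
      ext w
      simp
    rw [hre, him]
    apply Complex.ext <;> simp

theorem LinearMap.complexExtend_ofReal {X : Type*} (L : (X → ℝ) →ₗ[ℝ] ℝ) {F : X → ℂ} {G : X → ℝ}
    (h : ∀ w, F w = G w) : L.complexExtend F = L G := by
  apply Complex.ext
  · simp [complexExtend, h]
  · simp only [complexExtend, LinearMap.coe_mk, AddHom.coe_mk, h, Complex.ofReal_im]
    exact L.map_zero

theorem LinearMap.star_complexExtend {X : Type*} (L : (X → ℝ) →ₗ[ℝ] ℝ) (F : X → ℂ) :
    star (L.complexExtend F) = L.complexExtend (star F) := by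
  apply Complex.ext
  · simp [complexExtend]
  · simp only [complexExtend, LinearMap.coe_mk, AddHom.coe_mk, Pi.star_apply, Complex.star_def,
      Complex.conj_im]
    exact (L.map_neg fun w => (F w).im).symm

namespace CPOP

variable {n : ℕ}

/-! ### The functional of a complex moment sequence -/

@[simp]
theorem antiExp_zero : antiExp (0 : Fin n ⊕ Fin n →₀ ℕ) = 0 := by
  simp [antiExp]

@[simp]
theorem holExp_zero : holExp (0 : Fin n ⊕ Fin n →₀ ℕ) = 0 := by
  simp [holExp]

/-- The functional `L_y` on complex polynomials. -/
def momentC (y : MIdx n → MIdx n → ℂ) : CPoly n →ₗ[ℂ] ℂ :=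
  (MvPolynomial.basisMonomials _ ℂ).constr ℂ fun κ => y (antiExp κ) (holExp κ)

theorem momentC_monomial (y : MIdx n → MIdx n → ℂ) (κ : Fin n ⊕ Fin n →₀ ℕ) (c : ℂ) :
    momentC y (MvPolynomial.monomial κ c) = c * y (antiExp κ) (holExp κ) := by
  have h := (MvPolynomial.basisMonomials (Fin n ⊕ Fin n) ℂ).constr_basis ℂ
    (fun κ => y (antiExp κ) (holExp κ)) κ
  rw [MvPolynomial.coe_basisMonomials] at h
  rw [← mul_one c, ← smul_eq_mul, ← MvPolynomial.smul_monomial, map_smul, momentC, h, smul_eq_mul,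
    smul_eq_mul, mul_one]

theorem momentC_monomial_mul (y : MIdx n → MIdx n → ℂ) (κ : Fin n ⊕ Fin n →₀ ℕ) (c : ℂ)
    (φ : CPoly n) :
    momentC y (MvPolynomial.monomial κ c * φ) = c * shiftC y φ (antiExp κ) (holExp κ) := by
  conv_lhs => rw [φ.as_sum]
  simp only [Finset.mul_sum, map_sum, MvPolynomial.monomial_mul, momentC_monomial, shiftC,
    antiExp_add, holExp_add, mul_assoc]

theorem momentC_eq_shiftC (y : MIdx n → MIdx n → ℂ) (φ : CPoly n) :
    momentC y φ = shiftC y φ 0 0 := by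
  have := momentC_monomial_mul y 0 1 φ
  rwa [← MvPolynomial.C_apply, map_one, one_mul, one_mul, antiExp_zero, holExp_zero] at this

theorem momentC_C (y : MIdx n → MIdx n → ℂ) (c : ℂ) :
    momentC y (MvPolynomial.C c) = c * y 0 0 := by
  rw [MvPolynomial.C_apply, momentC_monomial, antiExp_zero, holExp_zero]

/-- The polynomial `|∑ x_α z^α|²` in `z̄, z`. -/
def hermitianSq {d : ℕ} (x : MIdxLE n d → ℂ) : CPoly n :=
  ∑ α, ∑ β, MvPolynomial.monomial (Finsupp.sumElim α.1 β.1) (star (x α) * x β)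

theorem evalC_hermitianSq {d : ℕ} (x : MIdxLE n d → ℂ) (z : Fin n → ℂ) :
    evalC (hermitianSq x) z = Complex.normSq (∑ α, x α * monom α.1 z) := by
  rw [← Complex.mul_conj, mul_comm, map_sum, Finset.sum_mul_sum]
  simp only [hermitianSq, evalC, map_sum, MvPolynomial.eval_monomial]
  refine Finset.sum_congr rfl fun α _ => Finset.sum_congr rfl fun β _ => ?_
  have := monom_sumElim (Finsupp.sumElim α.1 β.1) z
  rw [antiExp_sumElim, holExp_sumElim] at this
  rw [monom] at this
  rw [this]
  simp
  ring

open Matrix in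
theorem momentC_hermitianSq_mul {d : ℕ} (y : MIdx n → MIdx n → ℂ) (x : MIdxLE n d → ℂ)
    (φ : CPoly n) :
    momentC y (hermitianSq x * φ) = star x ⬝ᵥ (locC d φ y *ᵥ x) := by
  simp only [hermitianSq, Finset.sum_mul, map_sum, momentC_monomial_mul, antiExp_sumElim,
    holExp_sumElim, dotProduct, mulVec, Finset.mul_sum, locC, Matrix.of_apply, Pi.star_apply]
  refine Finset.sum_congr rfl fun α _ => Finset.sum_congr rfl fun β _ => ?_
  ring

/-- The weak-duality step: with `x` the coefficient vector of a holomorphic `p`, `L_y(|p|² φ)` is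
the Hermitian form `x* M_d(φy) x`. -/
theorem exists_polynomial_of_mem_convertedSOS {d : ℕ} {σ : (Fin n ⊕ Fin n → ℝ) → ℝ}
    (hσ : σ ∈ convertedSOS n d) :
    ∃ p : CPoly n, (∀ w, evalC p (toComplexPoint w) = σ w) ∧
      ∀ (y : MIdx n → MIdx n → ℂ) (φ : CPoly n), (locC d φ y).PosSemidef →
        0 ≤ momentC y (p * φ) := by
  obtain ⟨r, p, hp, hσ⟩ := hσ
  refine ⟨∑ j, hermitianSq fun α : MIdxLE n d => (p j).coeff α.1, fun w => ?_, fun y φ h => ?_⟩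
  · rw [hσ, evalC, map_sum]
    push_cast
    refine Finset.sum_congr rfl fun j _ => ?_
    change evalC _ _ = _
    rw [evalC_hermitianSq, ← eval_eq_sum_of_totalDegree_le (hp j)]
    rfl
  · rw [Finset.sum_mul, map_sum]
    refine Finset.sum_nonneg fun j _ => ?_
    rw [momentC_hermitianSq_mul]
    exact h.dotProduct_mulVec_nonneg _

/-! ### The moment sequence of a functional -/

/-- The moments `y_{α,β}` of the functional `L`. -/
def momentsC (L : ((Fin n ⊕ Fin n → ℝ) → ℝ) →ₗ[ℝ] ℝ) (α β : MIdx n) : ℂ :=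
  L.complexExtend fun w =>
    star (monom α (toComplexPoint w)) * monom β (toComplexPoint w)

theorem star_momentsC (L : ((Fin n ⊕ Fin n → ℝ) → ℝ) →ₗ[ℝ] ℝ) (α β : MIdx n) :
    star (momentsC L α β) = momentsC L β α := by
  rw [momentsC, LinearMap.star_complexExtend, momentsC]
  congr 1
  ext w
  simp [mul_comm]

theorem momentsC_zero (L : ((Fin n ⊕ Fin n → ℝ) → ℝ) →ₗ[ℝ] ℝ) : momentsC L 0 0 = L 1 :=
  L.complexExtend_ofReal fun w => by simp

theorem shiftC_momentsC (L : ((Fin n ⊕ Fin n → ℝ) → ℝ) →ₗ[ℝ] ℝ) (φ : CPoly n) (α β : MIdx n) :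
    shiftC (momentsC L) φ α β = L.complexExtend fun w =>
      star (monom α (toComplexPoint w)) * monom β (toComplexPoint w) *
        evalC φ (toComplexPoint w) := by
  simp only [shiftC, momentsC, ← smul_eq_mul (_ : ℂ) (LinearMap.complexExtend _ _), ← map_smul,
    ← map_sum]
  congr 1
  ext w
  simp only [Finset.sum_apply, Pi.smul_apply, smul_eq_mul, evalC_eq_sum, Finset.mul_sum, monom_add,
    star_mul']
  refine Finset.sum_congr rfl fun κ _ => ?_
  ring

open Matrix in
theorem star_dotProduct_locC_momentsC (L : ((Fin n ⊕ Fin n → ℝ) → ℝ) →ₗ[ℝ] ℝ) {d : ℕ}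
    (φ : CPoly n) (x : MIdxLE n d → ℂ) :
    star x ⬝ᵥ (locC d φ (momentsC L) *ᵥ x) = L.complexExtend fun w =>
      Complex.normSq (∑ α, x α * monom α.1 (toComplexPoint w)) * evalC φ (toComplexPoint w) := by
  have h : (fun w => (Complex.normSq (∑ α, x α * monom α.1 (toComplexPoint w)) : ℂ) *
      evalC φ (toComplexPoint w)) = ∑ α, ∑ β, (star (x α) * x β) • fun w =>
        star (monom α.1 (toComplexPoint w)) * monom β.1 (toComplexPoint w) *
          evalC φ (toComplexPoint w) := by
    ext w
    rw [← Complex.mul_conj, mul_comm (∑ α, _), map_sum, Finset.sum_mul_sum, Finset.sum_mul]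
    simp only [Finset.sum_apply, Finset.sum_mul, Pi.smul_apply, smul_eq_mul]
    refine Finset.sum_congr rfl fun α _ => Finset.sum_congr rfl fun β _ => ?_
    simp only [map_mul, Complex.star_def]
    ring
  rw [h]
  simp only [map_sum, map_smul, smul_eq_mul, dotProduct, mulVec, locC, Matrix.of_apply,
    shiftC_momentsC, Pi.star_apply, Finset.mul_sum]
  refine Finset.sum_congr rfl fun α _ => Finset.sum_congr rfl fun β _ => ?_
  ring

/-! ### Boundedness on the sphere and feasibility of the moments, complex case -/

variable {Q : PointedCone ℝ ((Fin n ⊕ Fin n → ℝ) → ℝ)} {d : ℕ}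

theorem re_evalC_mem_of_monom_mem {E : Submodule ℝ ((Fin n ⊕ Fin n → ℝ) → ℝ)}
    (hE : ∀ (c : ℂ) (α β : MIdx n), α.degree ≤ d → β.degree ≤ d → (fun w =>
      (c * (star (monom α (toComplexPoint w)) * monom β (toComplexPoint w))).re) ∈ E)
    {k : ℕ} (hk : k ≤ d) {φ : CPoly n} (hφ : order φ ≤ k) {α β : MIdx n} (hα : α.degree ≤ d - k)
    (hβ : β.degree ≤ d - k) (c : ℂ) :
    (fun w => (c * (star (monom α (toComplexPoint w)) * monom β (toComplexPoint w)) *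
      evalC φ (toComplexPoint w)).re) ∈ E := by
  have h : ∀ κ ∈ φ.support, (fun w => (c * φ.coeff κ *
      (star (monom (α + antiExp κ) (toComplexPoint w)) *
        monom (β + holExp κ) (toComplexPoint w))).re) ∈ E := by
    intro κ hκ
    obtain ⟨h1, h2⟩ := order_le_iff.1 hφ κ hκ
    refine hE _ _ _ ?_ ?_ <;> rw [map_add] <;> omega
  convert Submodule.sum_mem E h using 1
  ext w
  rw [Finset.sum_apply, ← Complex.re_sum, evalC_eq_sum, Finset.mul_sum]
  congr 1
  refine Finset.sum_congr rfl fun κ _ => ?_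
  rw [monom_add, monom_add, star_mul']
  ring

theorem posSemidef_locC_momentsC {L : ((Fin n ⊕ Fin n → ℝ) → ℝ) →ₗ[ℝ] ℝ}
    {E : Submodule ℝ ((Fin n ⊕ Fin n → ℝ) → ℝ)}
    (hE : ∀ (c : ℂ) (α β : MIdx n), α.degree ≤ d → β.degree ≤ d → (fun w =>
      (c * (star (monom α (toComplexPoint w)) * monom β (toComplexPoint w))).re) ∈ E)
    (hL : ∀ F ∈ Q, F ∈ E → 0 ≤ L F)
    {k : ℕ} (hk : k ≤ d) {φ : CPoly n} (hφ : order φ ≤ k) {g : (Fin n ⊕ Fin n → ℝ) → ℝ}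
    (hg : ∀ w, evalC φ (toComplexPoint w) = g w)
    (hQ : ∀ σ ∈ convertedSOSCone n (d - k), σ * g ∈ Q) :
    (locC (d - k) φ (momentsC L)).PosSemidef := by
  refine Matrix.PosSemidef.of_dotProduct_mulVec_nonneg ?_ fun x => ?_
  · ext α β
    simp only [Matrix.conjTranspose_apply, locC, Matrix.of_apply, shiftC_momentsC,
      LinearMap.star_complexExtend]
    congr 1
    ext w
    simp [hg, mul_comm]
  · have hx := normSq_mem_convertedSOSCone (totalDegree_polyOfCoeff x)
    have hF : ∀ w, (Complex.normSq (∑ α, x α * monom α.1 (toComplexPoint w)) : ℂ) *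
        evalC φ (toComplexPoint w) = (((fun w => Complex.normSq
          (MvPolynomial.eval (toComplexPoint w) (polyOfCoeff x))) * g) w : ℝ) := by
      intro w
      simp only [Pi.mul_apply, eval_polyOfCoeff, hg]
      push_cast
      rfl
    rw [star_dotProduct_locC_momentsC, L.complexExtend_ofReal hF]
    refine Complex.zero_le_real.2 (hL _ (hQ _ hx) ?_)
    -- `L` is nonnegative only on `Q ∩ E`, so `|p|² g` must be shown to lie in `E`. Its monomials
    -- have both exponents of length at most `(d - k) + k = d`.
    have h : ∑ α, ∑ β, (fun w => (star (x α) * x β * (star (monom α.1 (toComplexPoint w)) *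
        monom β.1 (toComplexPoint w)) * evalC φ (toComplexPoint w)).re) ∈ E :=
      Submodule.sum_mem _ fun α _ => Submodule.sum_mem _ fun β _ =>
        re_evalC_mem_of_monom_mem hE hk hφ α.2 β.2 _
    convert h using 1
    ext w
    rw [← Complex.ofReal_re ((_ * g) w), ← hF w, ← Complex.mul_conj, mul_comm (∑ α, _), map_sum,
      Finset.sum_mul_sum]
    simp only [Finset.sum_apply, Finset.sum_mul, Complex.re_sum]
    refine Finset.sum_congr rfl fun α _ => Finset.sum_congr rfl fun β _ => ?_
    congr 1
    simp only [map_mul, Complex.star_def]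
    ring

/-- Induction on the length, adding one variable `z_i` to `z^β`: `R^(2k+2) - |z^β z_i|²` equals `R²
(R^(2k) - |z^β|²) + |z^β|² (R² - ∑ |z_j|²) + ∑_{j ≠ i} |z^β z_j|²`. The multiplier `z^β` has degree
`k ≤ d - 1`, as the truncation requires. -/
theorem sub_normSq_monom_mem (hS : convertedSOSCone n d ≤ Q) {R : ℝ}
    (hR : ∀ σ ∈ convertedSOSCone n (d - 1),
      σ * (fun w => R ^ 2 - ∑ j, Complex.normSq (toComplexPoint w j)) ∈ Q)
    (k : ℕ) : ∀ α : MIdx n, α.degree = k → k ≤ d →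
      (fun w => (R ^ 2) ^ k - Complex.normSq (monom α (toComplexPoint w))) ∈ Q := by
  have hmon : ∀ (α : MIdx n) (w : Fin n ⊕ Fin n → ℝ), MvPolynomial.eval (toComplexPoint w)
      (MvPolynomial.monomial α 1) = monom α (toComplexPoint w) := fun α w => by
    rw [MvPolynomial.eval_monomial, one_mul, monom]
  have hdeg : ∀ {α : MIdx n} {e : ℕ}, α.degree ≤ e →
      (MvPolynomial.monomial α (1 : ℂ)).totalDegree ≤ e := fun h =>
    (MvPolynomial.totalDegree_monomial_le _ _).trans h
  induction k with
  | zero =>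
    intro α hα _
    obtain rfl : α = 0 := (Finsupp.degree_eq_zero_iff α).1 hα
    convert Q.zero_mem using 1
    ext w
    simp
  | succ k ih =>
    intro α hα hk
    obtain ⟨β, i, hβ, rfl⟩ := exists_eq_add_single hα
    have h1 := Q.smul_mem (sq_nonneg R) (ih β hβ (by omega))
    have h2 := hR _ (normSq_mem_convertedSOSCone (hdeg (α := β) (by omega)))
    have h3 := Submodule.sum_mem Q (t := Finset.univ.erase i) fun j _ =>
      hS (normSq_mem_convertedSOSCone (hdeg (α := β + Finsupp.single j 1) (by
        rw [map_add, Finsupp.degree_single]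
        omega)))
    convert Q.add_mem (Q.add_mem h1 h2) h3 using 1
    ext w
    simp only [Pi.add_apply, Pi.smul_apply, Pi.mul_apply, Finset.sum_apply, hmon, monom_add,
      monom_single_one, Complex.normSq_mul, smul_eq_mul, ← Finset.mul_sum]
    rw [← Finset.add_sum_erase _ _ (Finset.mem_univ i)]
    ring

/-- Expanding `|c̄ z^α + z^β|² ≥ 0` bounds `2 Re(c z̄^α z^β)` below by `-|c|² |z^α|² - |z^β|²`, and
the sphere bounds these squares. Replacing `c` by `-c` gives the other bound. -/
theorem re_monom_mem_boundedBy (hS : convertedSOSCone n d ≤ Q) {R : ℝ}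
    (hR : ∀ σ ∈ convertedSOSCone n (d - 1),
      σ * (fun w => R ^ 2 - ∑ j, Complex.normSq (toComplexPoint w j)) ∈ Q)
    (c : ℂ) (α β : MIdx n) (hα : α.degree ≤ d) (hβ : β.degree ≤ d) :
    (fun w => (c * (star (monom α (toComplexPoint w)) * monom β (toComplexPoint w))).re) ∈
      Q.boundedBy 1 := by
  have key : ∀ c : ℂ, ∃ N : ℝ, N • (1 : (Fin n ⊕ Fin n → ℝ) → ℝ) + (fun w =>
      (c * (star (monom α (toComplexPoint w)) * monom β (toComplexPoint w))).re) ∈ Q := by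
    intro c
    have hdeg : (MvPolynomial.monomial α (star c) + MvPolynomial.monomial β 1).totalDegree ≤ d :=
      (MvPolynomial.totalDegree_add _ _).trans (max_le
        ((MvPolynomial.totalDegree_monomial_le _ _).trans hα)
        ((MvPolynomial.totalDegree_monomial_le _ _).trans hβ))
    have h1 := hS (normSq_mem_convertedSOSCone hdeg)
    have h2 := Q.smul_mem (Complex.normSq_nonneg c) (sub_normSq_monom_mem hS hR _ α rfl hα)
    have h3 := sub_normSq_monom_mem hS hR _ β rfl hβ
    have h4 := Q.smul_mem (by norm_num : (0 : ℝ) ≤ 1 / 2) (Q.add_mem (Q.add_mem h1 h2) h3)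
    refine ⟨1 / 2 * (Complex.normSq c * (R ^ 2) ^ α.degree + (R ^ 2) ^ β.degree), ?_⟩
    convert h4 using 1
    ext w
    simp only [Pi.add_apply, Pi.smul_apply, Pi.one_apply, smul_eq_mul, map_add,
      MvPolynomial.eval_monomial, one_mul]
    simp only [← monom.eq_def]
    rw [Complex.normSq_add]
    simp only [Complex.normSq_mul, Complex.star_def, Complex.normSq_conj]
    have h5 : (starRingEnd ℂ c * monom α (toComplexPoint w) *
        starRingEnd ℂ (monom β (toComplexPoint w))).re =
        (c * (starRingEnd ℂ (monom α (toComplexPoint w)) * monom β (toComplexPoint w))).re := by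
      rw [← Complex.conj_re]
      congr 1
      simp
      ring
    rw [h5]
    ring
  refine ⟨?_, key c⟩
  obtain ⟨N, hN⟩ := key (-c)
  refine ⟨N, ?_⟩
  convert hN using 1
  ext w
  simp [sub_eq_add_neg]

theorem evalC_spherePoly (R : ℝ) (w : Fin n ⊕ Fin n → ℝ) :
    evalC (spherePoly n R) (toComplexPoint w) =
      ((R ^ 2 - ∑ j, Complex.normSq (toComplexPoint w j) : ℝ) : ℂ) := by
  push_cast
  simp only [evalC, spherePoly, map_sub, MvPolynomial.eval_C, map_sum, map_mul,
    MvPolynomial.eval_X, Sum.elim_inl, Sum.elim_inr, ← Complex.mul_conj]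
  simp [mul_comm]

end CPOP

/-! ### Strong duality for the complex relaxation -/

namespace ComplexPOP

open CPOP

variable {n m : ℕ} (P : ComplexPOP n m)

/-- Strong duality between the moment and the sum-of-squares form of the complex relaxation. -/
theorem complexMomentValue_eq_sosValue {R : ℝ} (hP : ∃ i, P.con i = spherePoly n R) {d : ℕ}
    (hd : P.dminC ≤ d) : P.complexMomentValue d = P.convertedSOSValue d := by
  have hobj : order P.obj ≤ d := (le_max_left _ _).trans hd
  have hcon : ∀ i, P.conOrder i ≤ d := fun i =>
    ((Finset.le_sup (f := P.conOrder) (Finset.mem_univ i)).trans (le_max_right _ _)).trans hd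
  let g : Fin m → (Fin n ⊕ Fin n → ℝ) → ℝ := fun i w => MvPolynomial.eval w (realify (P.con i))
  let f : (Fin n ⊕ Fin n → ℝ) → ℝ := fun w => MvPolynomial.eval w (realify P.obj)
  let Q := weightedCone (convertedSOSCone n d) (fun i => convertedSOSCone n (d - P.conOrder i)) g
  have hS : convertedSOSCone n d ≤ Q := fun σ => mem_weightedCone_left
  have hQ : ∀ i, ∀ σ ∈ convertedSOSCone n (d - P.conOrder i), σ * g i ∈ Q :=
    fun i _ hσ => mem_weightedCone_mul (S := fun i => convertedSOSCone n (d - P.conOrder i)) i hσ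
  let A : Set ℝ := {a | ∃ y : MIdx n → MIdx n → ℂ, (∀ α β, star (y α β) = y β α) ∧ y 0 0 = 1 ∧
    (locC d 1 y).PosSemidef ∧ (∀ i, (locC (d - P.conOrder i) (P.con i) y).PosSemidef) ∧
    a = (shiftC y P.obj 0 0).re}
  let B : Set ℝ := {t | f - t • 1 ∈ Q}
  have hA : P.complexMomentValue d = sInf ((fun x : ℝ => (x : EReal)) '' A) := by
    rw [complexMomentValue]
    congr 1
    ext v
    constructor
    · rintro ⟨y, h1, h2, h3, h4, rfl⟩
      exact ⟨_, ⟨y, h1, h2, h3, h4, rfl⟩, rfl⟩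
    · rintro ⟨_, ⟨y, h1, h2, h3, h4, rfl⟩, rfl⟩
      exact ⟨y, h1, h2, h3, h4, rfl⟩
  have hB : P.convertedSOSValue d = sSup ((fun x : ℝ => (x : EReal)) '' B) := by
    rw [convertedSOSValue]
    congr 1
    ext v
    refine exists_congr fun t => and_congr ?_ eq_comm
    refine exists_congr fun σ₀ => and_congr_right fun _ => exists_congr fun σ =>
      and_congr_right fun _ => forall_congr' fun w => ?_
    simp [f, g]
  rw [hA, hB]
  apply EReal.sInf_eq_sSup_of_duality
  · rintro _ ⟨y, -, h0, hM, hg, rfl⟩ t ⟨σ₀, h₀, σ, hσ, h⟩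
    obtain ⟨p₀, hp₀, hpos₀⟩ := exists_polynomial_of_mem_convertedSOS h₀
    choose p hp hpos using fun i => exists_polynomial_of_mem_convertedSOS (hσ i)
    -- The certificate is an identity of functions, whereas `L_y` acts on coefficients; the identity
    -- is therefore lifted to polynomials.
    have hid : P.obj = MvPolynomial.C (t : ℂ) + (p₀ * 1 + ∑ i, p i * P.con i) := by
      refine eq_of_evalC_eq fun w => ?_
      have h1 : evalC (MvPolynomial.C (t : ℂ) + (p₀ * 1 + ∑ i, p i * P.con i))
          (toComplexPoint w) = t + (evalC p₀ (toComplexPoint w) +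
            ∑ i, evalC (p i) (toComplexPoint w) * evalC (P.con i) (toComplexPoint w)) := by
        simp [evalC]
      rw [h1, hp₀, P.evalC_obj]
      simp only [hp, P.evalC_con]
      have hw := h w
      simp only [f, g, Pi.sub_apply, Pi.smul_apply, Pi.one_apply, smul_eq_mul, mul_one] at hw
      rw [sub_eq_iff_eq_add'] at hw
      exact_mod_cast hw
    rw [← momentC_eq_shiftC, hid, map_add, momentC_C, h0, mul_one, map_add, map_sum]
    have h1 := hpos₀ y 1 hM
    have h2 := Finset.sum_nonneg fun i (_ : i ∈ Finset.univ) => hpos i y (P.con i) (hg i)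
    have h3 := (Complex.nonneg_iff.1 (add_nonneg h1 h2)).1
    simpa using h3
  · intro t ht
    obtain ⟨i₀, hi₀⟩ := hP
    have hE := re_monom_mem_boundedBy (Q := Q) (d := d) hS (R := R) (by
      intro σ hσ
      -- Order at most `1` makes every multiplier of degree `d - 1` admissible for the sphere
      -- constraint.
      have hord : P.conOrder i₀ ≤ 1 := by
        rw [conOrder, hi₀]
        exact order_spherePoly_le n R
      have hg₀ : g i₀ = fun w => R ^ 2 - ∑ j, Complex.normSq (toComplexPoint w j) := by
        ext w
        have := P.evalC_con i₀ w
        rw [hi₀, evalC_spherePoly] at this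
        simp only [g, hi₀]
        exact_mod_cast this.symm
      rw [← hg₀]
      refine hQ i₀ σ ?_
      obtain ⟨r, p, hp, h⟩ := hσ
      exact ⟨r, p, fun j => (hp j).trans (Nat.sub_le_sub_left hord d), h⟩)
    have h1Q : (1 : (Fin n ⊕ Fin n → ℝ) → ℝ) ∈ Q := by
      have : (MvPolynomial.C 1 : MvPolynomial (Fin n) ℂ).totalDegree ≤ d := by simp
      convert hS (normSq_mem_convertedSOSCone this) using 1
      ext w
      simp
    have hf : f ∈ Q.boundedBy 1 := by
      have := re_evalC_mem_of_monom_mem hE le_rfl hobj (α := 0) (β := 0) (by simp) (by simp) 1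
      convert this using 1
      ext w
      simp [f, P.evalC_obj]
    obtain ⟨L, hpos, hL1, hLf⟩ := PointedCone.exists_state_le Q h1Q hf ht
    refine ⟨L f, ⟨momentsC L, star_momentsC L, ?_, ?_, fun i => ?_, ?_⟩, hLf⟩
    · rw [momentsC_zero, hL1, Complex.ofReal_one]
    -- The moment matrix is the localizing matrix of the constant `1`, of order `0`.
    · refine posSemidef_locC_momentsC hE hpos (Nat.zero_le d) (g := 1)
        (order_le_iff.2 fun κ hκ => ?_) (fun w => ?_) fun σ hσ => ?_
      · rw [← map_one MvPolynomial.C, MvPolynomial.C_apply] at hκ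
        have := Finset.mem_singleton.1 (MvPolynomial.support_monomial_subset hκ)
        subst this
        simp [antiExp, holExp]
      · simp [evalC]
      · rw [mul_one]
        exact hS hσ
    · exact posSemidef_locC_momentsC hE hpos (hcon i) le_rfl (P.evalC_con i) (hQ i)
    · rw [shiftC_momentsC, L.complexExtend_ofReal (G := f), Complex.ofReal_re]
      intro w
      simp [f, P.evalC_obj]

end ComplexPOP

/-! ### The real moment problem -/

namespace CPOP

variable {n : ℕ}

/-! ### The functional of a real moment sequence -/

/-- The functional `L_y` on real polynomials. -/
def momentR (y : (Fin n ⊕ Fin n →₀ ℕ) → ℝ) : RPoly n →ₗ[ℝ] ℝ :=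
  (MvPolynomial.basisMonomials _ ℝ).constr ℝ y

theorem momentR_monomial (y : (Fin n ⊕ Fin n →₀ ℕ) → ℝ) (κ : Fin n ⊕ Fin n →₀ ℕ) (c : ℝ) :
    momentR y (MvPolynomial.monomial κ c) = c * y κ := by
  have h := (MvPolynomial.basisMonomials (Fin n ⊕ Fin n) ℝ).constr_basis ℝ y κ
  rw [MvPolynomial.coe_basisMonomials] at h
  rw [← mul_one c, ← smul_eq_mul, ← MvPolynomial.smul_monomial, map_smul, momentR, h, smul_eq_mul,
    smul_eq_mul, mul_one]

theorem momentR_monomial_mul (y : (Fin n ⊕ Fin n →₀ ℕ) → ℝ) (κ : Fin n ⊕ Fin n →₀ ℕ) (c : ℝ)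
    (F : RPoly n) : momentR y (MvPolynomial.monomial κ c * F) = c * shiftR y F κ := by
  conv_lhs => rw [F.as_sum]
  simp only [Finset.mul_sum, map_sum, MvPolynomial.monomial_mul, momentR_monomial, shiftR,
    mul_assoc]

theorem momentR_eq_shiftR (y : (Fin n ⊕ Fin n →₀ ℕ) → ℝ) (F : RPoly n) :
    momentR y F = shiftR y F 0 := by
  have := momentR_monomial_mul y 0 1 F
  rwa [← MvPolynomial.C_apply, map_one, one_mul, one_mul] at this

theorem momentR_C (y : (Fin n ⊕ Fin n →₀ ℕ) → ℝ) (c : ℝ) :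
    momentR y (MvPolynomial.C c) = c * y 0 := by
  rw [MvPolynomial.C_apply, momentR_monomial]

open Matrix in
theorem momentR_sq_mul {d : ℕ} (y : (Fin n ⊕ Fin n →₀ ℕ) → ℝ)
    (x : {μ : Fin n ⊕ Fin n →₀ ℕ // μ.degree ≤ d} → ℝ) (F : RPoly n) :
    momentR y (polyOfCoeff x ^ 2 * F) = star x ⬝ᵥ (locR d F y *ᵥ x) := by
  rw [polyOfCoeff, sq, Finset.sum_mul_sum]
  simp only [Finset.sum_mul, map_sum, MvPolynomial.monomial_mul, momentR_monomial_mul, dotProduct,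
    mulVec, Finset.mul_sum, locR, Matrix.of_apply, star_trivial]
  refine Finset.sum_congr rfl fun α _ => Finset.sum_congr rfl fun β _ => ?_
  ring

theorem exists_polynomial_of_mem_realSOS {d : ℕ} {σ : (Fin n ⊕ Fin n → ℝ) → ℝ}
    (hσ : σ ∈ realSOS n d) :
    ∃ p : RPoly n, (∀ w, MvPolynomial.eval w p = σ w) ∧
      ∀ (y : (Fin n ⊕ Fin n →₀ ℕ) → ℝ) (F : RPoly n), (locR d F y).PosSemidef →
        0 ≤ momentR y (p * F) := by
  obtain ⟨r, q, hq, hσ⟩ := hσ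
  refine ⟨∑ j, polyOfCoeff (d := d) (fun α => (q j).coeff α.1) ^ 2, fun w => ?_, fun y F h => ?_⟩
  · rw [hσ, map_sum]
    refine Finset.sum_congr rfl fun j _ => ?_
    rw [map_pow, eval_polyOfCoeff, ← eval_eq_sum_of_totalDegree_le (hq j)]
  · rw [Finset.sum_mul, map_sum]
    refine Finset.sum_nonneg fun j _ => ?_
    rw [momentR_sq_mul]
    exact h.dotProduct_mulVec_nonneg _

/-! ### The moment sequence of a functional -/

/-- The moments `y_κ` of the functional `L`. -/
def momentsR (L : ((Fin n ⊕ Fin n → ℝ) → ℝ) →ₗ[ℝ] ℝ) (κ : Fin n ⊕ Fin n →₀ ℕ) : ℝ :=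
  L (monom κ)

theorem shiftR_momentsR (L : ((Fin n ⊕ Fin n → ℝ) → ℝ) →ₗ[ℝ] ℝ) (F : RPoly n)
    (μ : Fin n ⊕ Fin n →₀ ℕ) :
    shiftR (momentsR L) F μ = L fun w => monom μ w * MvPolynomial.eval w F := by
  have h : (fun w => monom μ w * MvPolynomial.eval w F) =
      ∑ κ ∈ F.support, F.coeff κ • monom (μ + κ) := by
    ext w
    simp only [Finset.sum_apply, Pi.smul_apply, smul_eq_mul, eval_eq_sum_monom, Finset.mul_sum,
      monom_add]
    refine Finset.sum_congr rfl fun κ _ => ?_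
    ring
  rw [h]
  simp only [map_sum, map_smul, smul_eq_mul, shiftR, momentsR]

open Matrix in
theorem dotProduct_locR_momentsR (L : ((Fin n ⊕ Fin n → ℝ) → ℝ) →ₗ[ℝ] ℝ) {d : ℕ} (F : RPoly n)
    (x : {μ : Fin n ⊕ Fin n →₀ ℕ // μ.degree ≤ d} → ℝ) :
    star x ⬝ᵥ (locR d F (momentsR L) *ᵥ x) =
      L fun w => MvPolynomial.eval w (polyOfCoeff x) ^ 2 * MvPolynomial.eval w F := by
  have h : (fun w => MvPolynomial.eval w (polyOfCoeff x) ^ 2 * MvPolynomial.eval w F) =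
      ∑ α, ∑ β, (x α * x β) • fun w => monom (α.1 + β.1) w * MvPolynomial.eval w F := by
    ext w
    rw [eval_polyOfCoeff, sq, Finset.sum_mul_sum, Finset.sum_mul]
    simp only [Finset.sum_apply, Finset.sum_mul, Pi.smul_apply, smul_eq_mul, monom_add]
    refine Finset.sum_congr rfl fun α _ => Finset.sum_congr rfl fun β _ => ?_
    ring
  rw [h]
  simp only [map_sum, map_smul, smul_eq_mul, dotProduct, mulVec, locR, Matrix.of_apply,
    shiftR_momentsR, star_trivial, Finset.mul_sum]
  refine Finset.sum_congr rfl fun α _ => Finset.sum_congr rfl fun β _ => ?_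
  ring

variable {Q : PointedCone ℝ ((Fin n ⊕ Fin n → ℝ) → ℝ)} {d : ℕ}

theorem eval_mem_of_monom_mem {E : Submodule ℝ ((Fin n ⊕ Fin n → ℝ) → ℝ)} {D : ℕ}
    (hE : ∀ κ : Fin n ⊕ Fin n →₀ ℕ, κ.degree ≤ D → monom κ ∈ E) {F : RPoly n}
    (hF : F.totalDegree ≤ D) : (fun w => MvPolynomial.eval w F) ∈ E := by
  convert Submodule.sum_mem E fun κ hκ =>
    E.smul_mem (F.coeff κ) (hE κ (totalDegree_le_iff.1 hF κ hκ)) using 1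
  ext w
  simp [eval_eq_sum_monom]

theorem posSemidef_locR_momentsR {L : ((Fin n ⊕ Fin n → ℝ) → ℝ) →ₗ[ℝ] ℝ}
    {E : Submodule ℝ ((Fin n ⊕ Fin n → ℝ) → ℝ)}
    (hE : ∀ κ : Fin n ⊕ Fin n →₀ ℕ, κ.degree ≤ 2 * d → monom κ ∈ E)
    (hL : ∀ F ∈ Q, F ∈ E → 0 ≤ L F) {e : ℕ} (he : e ≤ d) {F : RPoly n}
    (hF : F.totalDegree ≤ 2 * e)
    (hQ : ∀ σ ∈ realSOSCone n (d - e), σ * (fun w => MvPolynomial.eval w F) ∈ Q) :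
    (locR (d - e) F (momentsR L)).PosSemidef := by
  refine Matrix.PosSemidef.of_dotProduct_mulVec_nonneg ?_ fun x => ?_
  · ext α β
    simp [locR, add_comm]
  · have hx := totalDegree_polyOfCoeff x
    rw [dotProduct_locR_momentsR]
    refine hL _ (hQ _ (sq_mem_realSOSCone hx)) ?_
    have hdeg : (polyOfCoeff x ^ 2 * F).totalDegree ≤ 2 * d := by
      have h1 := MvPolynomial.totalDegree_mul (polyOfCoeff x ^ 2) F
      have h2 := MvPolynomial.totalDegree_pow (polyOfCoeff x) 2
      omega
    simpa using eval_mem_of_monom_mem hE hdeg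

/-- The induction of `sub_normSq_monom_mem`, with the `2n` real coordinates in place of the `z_j`.
-/
theorem sub_sq_monom_mem (hS : realSOSCone n d ≤ Q) {R : ℝ}
    (hR : ∀ σ ∈ realSOSCone n (d - 1), σ * (fun w => R ^ 2 - ∑ s, w s ^ 2) ∈ Q)
    (k : ℕ) : ∀ α : Fin n ⊕ Fin n →₀ ℕ, α.degree = k → k ≤ d →
      (fun w => (R ^ 2) ^ k - monom α w ^ 2) ∈ Q := by
  have hmon : ∀ (α : Fin n ⊕ Fin n →₀ ℕ) (w : Fin n ⊕ Fin n → ℝ),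
      MvPolynomial.eval w (MvPolynomial.monomial α 1) = monom α w := fun α w => by
    rw [MvPolynomial.eval_monomial, one_mul, monom]
  have hdeg : ∀ {α : Fin n ⊕ Fin n →₀ ℕ} {e : ℕ}, α.degree ≤ e →
      (MvPolynomial.monomial α (1 : ℝ)).totalDegree ≤ e := fun h =>
    (MvPolynomial.totalDegree_monomial_le _ _).trans h
  induction k with
  | zero =>
    intro α hα _
    obtain rfl : α = 0 := (Finsupp.degree_eq_zero_iff α).1 hα
    convert Q.zero_mem using 1
    ext w
    simp
  | succ k ih =>
    intro α hα hk
    obtain ⟨β, i, hβ, rfl⟩ := exists_eq_add_single hα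
    have h1 := Q.smul_mem (sq_nonneg R) (ih β hβ (by omega))
    have h2 := hR _ (sq_mem_realSOSCone (hdeg (α := β) (by omega)))
    have h3 := Submodule.sum_mem Q (t := Finset.univ.erase i) fun j _ =>
      hS (sq_mem_realSOSCone (hdeg (α := β + Finsupp.single j 1) (by
        rw [map_add, Finsupp.degree_single]
        omega)))
    convert Q.add_mem (Q.add_mem h1 h2) h3 using 1
    ext w
    simp only [Pi.add_apply, Pi.smul_apply, Pi.mul_apply, Finset.sum_apply, hmon, monom_add,
      monom_single_one, mul_pow, smul_eq_mul, ← Finset.mul_sum]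
    rw [← Finset.add_sum_erase _ _ (Finset.mem_univ i)]
    ring

theorem monom_mem_boundedBy (hS : realSOSCone n d ≤ Q) {R : ℝ}
    (hR : ∀ σ ∈ realSOSCone n (d - 1), σ * (fun w => R ^ 2 - ∑ s, w s ^ 2) ∈ Q)
    (κ : Fin n ⊕ Fin n →₀ ℕ) (hκ : κ.degree ≤ 2 * d) : monom κ ∈ Q.boundedBy 1 := by
  -- A monomial of degree at most `2d` splits into two factors of degree at most `d`: the first
  -- takes `min |κ| d`, which leaves at most `d` for the second. The square `(c α-factor +
  -- β-factor)²` with `c = ±1` then gives both bounds.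
  obtain ⟨α, hακ, hα⟩ := Finsupp.exists_le_degree_eq κ (min κ.degree d) (min_le_left _ _)
  obtain ⟨β, rfl⟩ := exists_add_of_le hακ
  have hα' : α.degree ≤ d := by omega
  have hβ' : β.degree ≤ d := by
    rw [map_add] at hκ hα
    omega
  have key : ∀ c : ℝ, c ^ 2 = 1 → ∃ N : ℝ,
      N • (1 : (Fin n ⊕ Fin n → ℝ) → ℝ) + c • monom (α + β) ∈ Q := by
    intro c hc
    have hdeg : (MvPolynomial.monomial α c + MvPolynomial.monomial β 1).totalDegree ≤ d :=
      (MvPolynomial.totalDegree_add _ _).trans (max_le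
        ((MvPolynomial.totalDegree_monomial_le _ _).trans hα')
        ((MvPolynomial.totalDegree_monomial_le _ _).trans hβ'))
    have h1 := hS (sq_mem_realSOSCone hdeg)
    have h2 := sub_sq_monom_mem hS hR _ α rfl hα'
    have h3 := sub_sq_monom_mem hS hR _ β rfl hβ'
    have h4 := Q.smul_mem (by norm_num : (0 : ℝ) ≤ 1 / 2) (Q.add_mem (Q.add_mem h1 h2) h3)
    refine ⟨1 / 2 * ((R ^ 2) ^ α.degree + (R ^ 2) ^ β.degree), ?_⟩
    convert h4 using 1
    ext w
    simp only [Pi.add_apply, Pi.smul_apply, Pi.one_apply, smul_eq_mul, map_add,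
      MvPolynomial.eval_monomial, one_mul, monom_add]
    simp only [← monom.eq_def]
    linear_combination -(1 / 2) * monom α w ^ 2 * hc
  refine ⟨?_, by simpa using key 1 (by norm_num)⟩
  obtain ⟨N, hN⟩ := key (-1) (by norm_num)
  exact ⟨N, by simpa [sub_eq_add_neg] using hN⟩

theorem eval_realify_spherePoly (R : ℝ) (w : Fin n ⊕ Fin n → ℝ) :
    MvPolynomial.eval w (realify (spherePoly n R)) = R ^ 2 - ∑ s, w s ^ 2 := by
  rw [eval_realify, evalC_spherePoly, Complex.ofReal_re, Fintype.sum_sum_type,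
    ← Finset.sum_add_distrib]
  congr 1
  refine Finset.sum_congr rfl fun j _ => ?_
  simp [toComplexPoint, Complex.normSq_apply, sq]

end CPOP

/-! ### Strong duality for the real relaxation -/

namespace ComplexPOP

open CPOP

variable {n m : ℕ} (P : ComplexPOP n m)

/-- Strong duality between the moment and the sum-of-squares form of the real relaxation, for
multipliers truncated at any orders `e_i ≥ ⌈deg g̃_i / 2⌉` that are at most `1` at the sphere. -/
theorem realMomentValue_eq_realSOSValue {R : ℝ} {e : Fin m → ℕ}
    (hP : ∃ i, P.con i = spherePoly n R ∧ e i ≤ 1) {d : ℕ}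
    (hobj : (realify P.obj).totalDegree ≤ 2 * d) (hed : ∀ i, e i ≤ d)
    (hcon : ∀ i, (realify (P.con i)).totalDegree ≤ 2 * e i) :
    P.realMomentValue e d = P.realSOSValue e d := by
  let g : Fin m → (Fin n ⊕ Fin n → ℝ) → ℝ := fun i w => MvPolynomial.eval w (realify (P.con i))
  let f : (Fin n ⊕ Fin n → ℝ) → ℝ := fun w => MvPolynomial.eval w (realify P.obj)
  let Q := weightedCone (realSOSCone n d) (fun i => realSOSCone n (d - e i)) g
  have hS : realSOSCone n d ≤ Q := fun σ => mem_weightedCone_left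
  have hQ : ∀ i, ∀ σ ∈ realSOSCone n (d - e i), σ * g i ∈ Q :=
    fun i _ hσ => mem_weightedCone_mul (S := fun i => realSOSCone n (d - e i)) i hσ
  let A : Set ℝ := {a | ∃ y : (Fin n ⊕ Fin n →₀ ℕ) → ℝ, y 0 = 1 ∧
    (locR d 1 y).PosSemidef ∧ (∀ i, (locR (d - e i) (realify (P.con i)) y).PosSemidef) ∧
    a = shiftR y (realify P.obj) 0}
  let B : Set ℝ := {t | f - t • 1 ∈ Q}
  have hA : P.realMomentValue e d = sInf ((fun x : ℝ => (x : EReal)) '' A) := by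
    rw [realMomentValue]
    congr 1
    ext v
    constructor
    · rintro ⟨y, h1, h2, h3, rfl⟩
      exact ⟨_, ⟨y, h1, h2, h3, rfl⟩, rfl⟩
    · rintro ⟨_, ⟨y, h1, h2, h3, rfl⟩, rfl⟩
      exact ⟨y, h1, h2, h3, rfl⟩
  have hB : P.realSOSValue e d = sSup ((fun x : ℝ => (x : EReal)) '' B) := by
    rw [realSOSValue]
    congr 1
    ext v
    refine exists_congr fun t => and_congr ?_ eq_comm
    refine exists_congr fun σ₀ => and_congr_right fun _ => exists_congr fun σ =>
      and_congr_right fun _ => forall_congr' fun w => ?_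
    simp [f, g]
  rw [hA, hB]
  apply EReal.sInf_eq_sSup_of_duality
  · rintro _ ⟨y, h0, hM, hg, rfl⟩ t ⟨σ₀, h₀, σ, hσ, h⟩
    obtain ⟨p₀, hp₀, hpos₀⟩ := exists_polynomial_of_mem_realSOS h₀
    choose p hp hpos using fun i => exists_polynomial_of_mem_realSOS (hσ i)
    have hid : realify P.obj =
        MvPolynomial.C t + (p₀ * 1 + ∑ i, p i * realify (P.con i)) := by
      refine MvPolynomial.funext fun w => ?_
      have hw := h w
      simp only [f, g, Pi.sub_apply, Pi.smul_apply, Pi.one_apply, smul_eq_mul, mul_one] at hw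
      rw [sub_eq_iff_eq_add'] at hw
      simpa [hp₀, hp] using hw
    rw [← momentR_eq_shiftR, hid, map_add, momentR_C, h0, mul_one, map_add, map_sum]
    have h1 := hpos₀ y 1 hM
    have h2 := Finset.sum_nonneg fun i (_ : i ∈ Finset.univ) =>
      hpos i y (realify (P.con i)) (hg i)
    linarith
  · intro t ht
    obtain ⟨i₀, hi₀, hei₀⟩ := hP
    have hE := monom_mem_boundedBy (Q := Q) (d := d) hS (R := R) (by
      intro σ hσ
      have hg₀ : g i₀ = fun w => R ^ 2 - ∑ s, w s ^ 2 := by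
        ext w
        simp only [g, hi₀, eval_realify_spherePoly]
      rw [← hg₀]
      exact hQ i₀ σ (realSOS_mono (Nat.sub_le_sub_left hei₀ d) hσ))
    have h1Q : (1 : (Fin n ⊕ Fin n → ℝ) → ℝ) ∈ Q := by
      have : (MvPolynomial.C 1 : RPoly n).totalDegree ≤ d := by simp
      convert hS (sq_mem_realSOSCone this) using 1
      ext w
      simp
    obtain ⟨L, hpos, hL1, hLf⟩ :=
      PointedCone.exists_state_le Q h1Q (eval_mem_of_monom_mem hE hobj) ht
    refine ⟨L f, ⟨momentsR L, ?_, ?_, fun i => ?_, ?_⟩, hLf⟩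
    · rw [momentsR, ← hL1]
      congr 1
    · refine posSemidef_locR_momentsR hE hpos (Nat.zero_le d) (by simp) fun σ hσ => ?_
      have : (fun w => MvPolynomial.eval w (1 : RPoly n)) = 1 := by
        ext w
        simp
      rw [this, mul_one]
      exact hS hσ
    · exact posSemidef_locR_momentsR hE hpos (hed i) (hcon i) (hQ i)
    · rw [shiftR_momentsR]
      simp [f]

end ComplexPOP

end

theorem mainTheorem5 (n m : ℕ) (hn : 0 < n) (P : ComplexPOP n m) (hP : P.SphereAssumption)
    (d : ℕ) (hd : max P.dminR P.dminC ≤ d) :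
    -- each relaxation has one value: its moment and sum-of-squares forms agree
    (P.complexMomentValue d = P.complexSOSValue d ∧
      P.convertedMomentValue d = P.convertedSOSValue d ∧
      P.realMomentValue P.conHalfDegree d = P.realSOSValue P.conHalfDegree d ∧
      P.realMomentValue P.conOrder d = P.realSOSValue P.conOrder d) ∧
    -- the complex relaxation and its conversion into real numbers have the same value
    P.complexMomentValue d = P.convertedMomentValue d ∧
    -- this value is at most that of the real Lasserre relaxation, and even at most that of its
    -- restriction in which the multipliers are truncated at the complex orders
    P.convertedMomentValue d ≤ P.realMomentValue P.conHalfDegree d ∧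
    P.convertedMomentValue d ≤ P.realMomentValue P.conOrder d := by
  obtain ⟨R, -, ⟨i₀, hi₀⟩, -⟩ := hP
  obtain ⟨hdR, hdC⟩ := max_le_iff.1 hd
  have hobj : (CPOP.realify P.obj).totalDegree ≤ 2 * d :=
    (CPOP.totalDegree_le_two_mul_halfDegree _).trans
      (Nat.mul_le_mul_left 2 ((le_max_left _ _).trans hdR))
  have hhalf : ∀ i, P.conHalfDegree i ≤ P.conOrder i := fun i =>
    CPOP.halfDegree_realify_le_order _
  have hord : ∀ i, P.conOrder i ≤ d := fun i =>
    ((Finset.le_sup (f := P.conOrder) (Finset.mem_univ i)).trans (le_max_right _ _)).trans hdC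
  have hi₁ : P.conOrder i₀ ≤ 1 := by
    rw [ComplexPOP.conOrder, hi₀]
    exact CPOP.order_spherePoly_le n R
  have hdeg : ∀ i, (CPOP.realify (P.con i)).totalDegree ≤ 2 * P.conHalfDegree i := fun i =>
    CPOP.totalDegree_le_two_mul_halfDegree _
  have hC := P.complexMomentValue_eq_sosValue ⟨i₀, hi₀⟩ hdC
  have hCR := P.complexMomentValue_eq_convertedMomentValue d
  -- Both truncations, by `v_i` and by `k_i`, satisfy `deg g̃_i ≤ 2 e_i` and `e_i ≤ d`, with `e_i ≤
  -- 1` at the sphere, so the same duality theorem serves twice.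
  have hR := P.realMomentValue_eq_realSOSValue (e := P.conHalfDegree)
    ⟨i₀, hi₀, (hhalf i₀).trans hi₁⟩ hobj (fun i => (hhalf i).trans (hord i)) hdeg
  have hR' := P.realMomentValue_eq_realSOSValue (e := P.conOrder) ⟨i₀, hi₀, hi₁⟩ hobj hord
    fun i => (hdeg i).trans (Nat.mul_le_mul_left 2 (hhalf i))
  refine ⟨⟨hC.trans (P.complexSOSValue_eq_convertedSOSValue d).symm, hCR.symm.trans hC, hR, hR'⟩,
    hCR, ?_, ?_⟩
  -- Duality moves both sides to sums of squares, where the inequality is an inclusion of feasible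
  -- sets.
  · rw [← hCR, hC, hR]
    exact P.convertedSOSValue_le_realSOSValue hhalf d
  · rw [← hCR, hC, hR']
    exact P.convertedSOSValue_le_realSOSValue (fun _ => le_rfl) d
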